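/- **Theorem 2.** Let $p\equiv 1\pmod 3$ be a prime, $s,m\ge 1$, $q=p^s$, $r=q^m$, and let $\alpha$ be a generator of $\mathbb F_r^*$. Let $h\mid q-1$, $e=3$ with $3\mid\gcd(q-1,hm)$, and put $$g=\alpha^{(q-1)/h},\quad n=\frac{h(r-1)}{q-1},\quad \beta=\alpha^{(r-1)/3},\quad N=\gcd\Bigl(\frac{r-1}{q-1},\frac{3(q-1)}{h}\Bigr).$$ Assume $N=3$. Let $\mathcal C$ be the code over $\mathbb F_q$ of all words $c_{(a,b)}=\bigl(\mathrm{Tr}_{r/q}(ag^i+b(\beta g)^i)\bigr)_{i=0}^{n-1}$, $a,b\in\mathbb F_r$. Let $\psi(x)=\exp\bigl(\tfrac{2\pi i}{p}\mathrm{Tr}_{r/p}(x)\bigr)$, let $\eta_u=\sum_{z\in\langle\alpha^3\rangle}\psi(zu)$ for $u\in\mathbb F_r$, and let $\lambda(a,b)=\frac hq\sum_{i=1}^3\eta_{(a+\beta^ib)g^i}$ be the modified weight. Then the Hamming weight satisfies $$w(c_{(a,b)})=\frac{h(r-1)}q-\lambda(a,b)\qquad(a,b\in\mathbb F_r).$$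 Let $\omega=\frac{-1+\sqrt{-3}}2$. There is a $\pi\in\mathbb Z[\omega]$, unique up to complex conjugation, with $\pi\bar\pi=p$ and $\pi\equiv-1\pmod 3$. For each of the two choices of $\pi$ the following holds. The ring $\mathbb Z[\omega]/\pi\mathbb Z[\omega]$ is isomorphic to $\mathbb F_p$. Let $\bigl(\frac{\cdot}{\pi}\bigr)_3$ be the cubic residue symbol: $\bigl(\frac{a}{\pi}\bigr)_3=0$ if $\pi\mid a$, and otherwise it is the cube root of unity congruent to $a^{(p-1)/3}$ modulo $\pi$. Then $\rho(x)=\bigl(\frac{N_{r/p}(x)}{\pi}\bigr)_3$, where $N_{r/p}$ is the norm to $\mathbb F_p=\mathbb Z[\omega]/\pi\mathbb Z[\omega]$, is a multiplicative character of $\mathbb F_r$ of order $3$, and $$\eta_1=\frac{(-1)^{sm+1}r^{1/3}(\pi^{sm/3}+\bar\pi^{sm/3})-1}3,$$ $$\eta_\alpha=\frac{(-1)^{sm+1}r^{1/3}(\rho^2(\alpha)\pi^{sm/3}+\rho(\alpha)\bar\pi^{sm/3})-1}3,$$ $$\eta_{\alpha^2}=\frac{(-1)^{sm+1}r^{1/3}(\rho(\alpha)\pi^{sm/3}+\rho^2(\alpha)\bar\pi^{sm/3})-1}3.$$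 Put $S_j=(-1)^{ms}\bigl(\rho^j(\alpha)\pi^{ms}+\rho^{2j}(\alpha)\bar\pi^{ms}\bigr)$ for $j=0,1,2$. The distribution of the modified weights, over the pairs $(a,b)\in\mathbb F_r^2$ and likewise over the codewords of $\mathcal C$ (the modified weight of a codeword $c$ being $\frac{h(r-1)}q-w(c)$), is given by the following rows, where all frequencies are natural numbers and frequencies of rows with equal weights are added. | Weight | Frequency | |---|---| | $\frac{3h}q\eta_u$, for each $u\in\{1,\alpha,\alpha^2\}$ | $A$ | | $\frac hq(2\eta_1+\eta_\alpha)$, $\ \frac hq(2\eta_\alpha+\eta_{\alpha^2})$, $\ \frac hq(2\eta_{\alpha^2}+\eta_1)$ | $\frac{r-1}9(r-2-S_2)$ each | | $\frac hq(2\eta_1+\eta_{\alpha^2})$, $\ \frac hq(2\eta_\alpha+\eta_1)$, $\ \frac hq(2\eta_{\alpha^2}+\eta_\alpha)$ | $\frac{r-1}9(r-2-S_1)$ each | | $-\frac hq$ | $B$ | | $W_1,\ W_2,\ W_3$ | $r-1$ each | | $\frac{h(r-1)}q$ | $1$ | 1. If $3\mid\frac{q-1}h$, then $A=\frac{r-1}{27}(r-8-S_0)$,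 $B=\frac{2(r-1)}9(r+1-S_0)$, and $W_1,W_2,W_3$ are $\frac h{3q}(r-1+6\eta_u)$ for $u=1,\alpha,\alpha^2$. 2. If $3\nmid\frac{q-1}h$, then $A=\frac{r-1}{27}(r+1-S_0)$, $B=\frac{r-1}9(2r-7-2S_0)$, and $W_1,W_2,W_3$ are $\frac hq\bigl(\frac{r-1}3+\eta_u+\eta_v\bigr)$ for $\{u,v\}=\{1,\alpha\},\{1,\alpha^2\},\{\alpha,\alpha^2\}$. -/

import Mathlib

open scoped ComplexConjugate

noncomputable section

namespace CyclicCode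

/-! ### The ring `ℤ[ω]` and the cubic residue symbol -/

/-- The primitive cube root of unity `ω = (-1 + √-3) / 2`. -/
def omega : ℂ := (-1 + (Real.sqrt 3 : ℂ) * Complex.I) / 2

/-- The ring `ℤ[ω]`, as a subring of `ℂ`. -/
abbrev ZOmega : Subalgebra ℤ ℂ := Algebra.adjoin ℤ {omega}

/-- `ω` as an element of `ℤ[ω]`. -/
def omegaInt : ZOmega := ⟨omega, Algebra.subset_adjoin (Set.mem_singleton omega)⟩

/-- `ϖ ∈ ℤ[ω]` satisfies `ϖ * conj ϖ = p` and `ϖ ≡ -1 (mod 3)`. -/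
def IsPrimaryOver (p : ℕ) (ϖ : ZOmega) : Prop :=
  (ϖ : ℂ) * conj (ϖ : ℂ) = (p : ℂ) ∧ (3 : ZOmega) ∣ ϖ - (-1)

/-- The norm `N ϖ = |ϖ| ^ 2` (a natural number) of `ϖ ∈ ℤ[ω]`. -/
def eisensteinNorm (ϖ : ZOmega) : ℕ := ⌊Complex.normSq (ϖ : ℂ)⌋₊

open Classical in
/-- The cubic residue symbol `(a / ϖ)₃`: it is `0` if `ϖ ∣ a`, and otherwise the cube root of
unity congruent to `a ^ ((N ϖ - 1) / 3)` modulo `ϖ`. -/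
def cubicResidueSymbol (a ϖ : ZOmega) : ℂ :=
  if ϖ ∣ a then 0
  else if ϖ ∣ a ^ ((eisensteinNorm ϖ - 1) / 3) - 1 then 1
  else if ϖ ∣ a ^ ((eisensteinNorm ϖ - 1) / 3) - omegaInt then omega
  else if ϖ ∣ a ^ ((eisensteinNorm ϖ - 1) / 3) - omegaInt ^ 2 then omega ^ 2
  else 0

/-- The function on `F ⊇ 𝔽_p` arising from `(· / ϖ)₃`: the norm of `x` to `𝔽_p`, viewed in
`ℤ[ω] / ϖ ℤ[ω]` through an integer that represents it, is put into the cubic residue symbol. -/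
def rho (p : ℕ) {F : Type*} [Field F] [Algebra (ZMod p) F] (ϖ : ZOmega) (x : F) : ℂ :=
  cubicResidueSymbol (((Algebra.norm (ZMod p) x).val : ℕ) : ZOmega) ϖ

/-! ### Gaussian periods -/

/-- The canonical additive character `ψ(x) = exp (2πi Tr(x) / p)` of `F ⊇ 𝔽_p`. -/
def psi (p : ℕ) {F : Type*} [Field F] [Algebra (ZMod p) F] (x : F) : ℂ :=
  Complex.exp (2 * (Real.pi : ℂ) * Complex.I / (p : ℂ) * ((Algebra.trace (ZMod p) F x).val : ℂ))

open Classical in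
/-- `η_u^{(N,r)} = ∑ ψ(z u)`, the sum over the subgroup of `Fˣ` generated by `α ^ N`. -/
def gaussPeriod (p : ℕ) {F : Type*} [Field F] [Fintype F] [Algebra (ZMod p) F]
    (α : Fˣ) (N : ℕ) (u : F) : ℂ :=
  ∑ z : Fˣ with z ∈ Subgroup.zpowers (α ^ N), psi p ((z : F) * u)

/-! ### The code -/

/-- The length `n = h (r - 1) / (q - 1)`; here `q - 1` divides `r - 1`. -/
def codeLength (q r h : ℕ) : ℕ := h * ((r - 1) / (q - 1))

/-- `N = gcd ((r - 1) / (q - 1), e (q - 1) / h)`; here `h` divides `q - 1`. -/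
def paramN (q r h e : ℕ) : ℕ := Nat.gcd ((r - 1) / (q - 1)) (e * ((q - 1) / h))

/-- `g = α ^ ((q - 1) / h)`. -/
def gElt {F : Type*} [Field F] (α : Fˣ) (q h : ℕ) : F := (α : F) ^ ((q - 1) / h)

/-- `β = α ^ ((r - 1) / e)`. -/
def betaElt {F : Type*} [Field F] (α : Fˣ) (r e : ℕ) : F := (α : F) ^ ((r - 1) / e)

/-- The codeword `c_(a,b) = (Tr (a g ^ i + b (β g) ^ i))_{0 ≤ i < n}`, with `Tr : F → K`. -/
def codeword (K : Type*) [Field K] {F : Type*} [Field F] [Algebra K F]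
    (α : Fˣ) (q r h e : ℕ) (a b : F) : Fin (codeLength q r h) → K :=
  fun i => Algebra.trace K F
    (a * gElt α q h ^ (i : ℕ) + b * (betaElt α r e * gElt α q h) ^ (i : ℕ))

/-- The code `C_(q,m,h,e)`, the set of all codewords `c_(a,b)`. -/
def code (K : Type*) [Field K] {F : Type*} [Field F] [Algebra K F]
    (α : Fˣ) (q r h e : ℕ) : Set (Fin (codeLength q r h) → K) :=
  Set.range fun x : F × F => codeword K α q r h e x.1 x.2

/-- The modified weight
`λ(a,b) = h N / (e q) * ∑_{i=1}^{e} η^{(N,r)}_{(a + β ^ i b) g ^ i}`. -/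
def modifiedWeight (p : ℕ) {F : Type*} [Field F] [Fintype F] [Algebra (ZMod p) F]
    (α : Fˣ) (q r h e : ℕ) (a b : F) : ℂ :=
  (h : ℂ) * (paramN q r h e : ℂ) / ((e : ℂ) * (q : ℂ)) *
    ∑ i ∈ Finset.Icc 1 e,
      gaussPeriod p α (paramN q r h e) ((a + betaElt α r e ^ i * b) * gElt α q h ^ i)

/-! ### Weight distributions given by a table -/

/-- The values `val x`, `x ∈ X`, are distributed as in the table with rows
`(weight i, freq i)`: the frequencies are natural numbers, and each value `w` is taken exactly as
often as the rows with weight `w` say, frequencies of rows with equal weights being added. -/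
def IsDistributedAs {X ι : Type*} [Fintype ι] (val : X → ℂ) (weight freq : ι → ℂ) : Prop :=
  ∃ f : ι → ℕ, (∀ i, (f i : ℂ) = freq i) ∧
    open Classical in
    ∀ w : ℂ, Nat.card {x : X // val x = w} = ∑ i with weight i = w, f i

/-- The weights when `3 ∣ (q - 1) / h`; `x`, `y`, `z` stand for
the periods `η_1`, `η_α`, `η_{α²}`. -/
def weightsA (h q r x y z : ℂ) : Fin 14 → ℂ :=
  ![3 * h / q * x,
    3 * h / q * y,
    3 * h / q * z,
    h / q * (2 * x + y),
    h / q * (2 * x + z),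
    h / q * (2 * y + x),
    h / q * (2 * y + z),
    h / q * (2 * z + x),
    h / q * (2 * z + y),
    -(h / q),
    h / (3 * q) * (r - 1 + 6 * x),
    h / (3 * q) * (r - 1 + 6 * y),
    h / (3 * q) * (r - 1 + 6 * z),
    h * (r - 1) / q]

/-- The frequencies when `3 ∣ (q - 1) / h`; `k` stands for `m s`, `t` for `ρ(α)`. -/
def freqsA (r : ℂ) (k : ℕ) (ϖ t : ℂ) : Fin 14 → ℂ :=
  ![(r - 1) / 27 * (r - 8 - (-1) ^ k * (ϖ ^ k + conj ϖ ^ k)),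
    (r - 1) / 27 * (r - 8 - (-1) ^ k * (ϖ ^ k + conj ϖ ^ k)),
    (r - 1) / 27 * (r - 8 - (-1) ^ k * (ϖ ^ k + conj ϖ ^ k)),
    (r - 1) / 9 * (r - 2 - (-1) ^ k * (t ^ 2 * ϖ ^ k + t * conj ϖ ^ k)),
    (r - 1) / 9 * (r - 2 - (-1) ^ k * (t * ϖ ^ k + t ^ 2 * conj ϖ ^ k)),
    (r - 1) / 9 * (r - 2 - (-1) ^ k * (t * ϖ ^ k + t ^ 2 * conj ϖ ^ k)),
    (r - 1) / 9 * (r - 2 - (-1) ^ k * (t ^ 2 * ϖ ^ k + t * conj ϖ ^ k)),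
    (r - 1) / 9 * (r - 2 - (-1) ^ k * (t ^ 2 * ϖ ^ k + t * conj ϖ ^ k)),
    (r - 1) / 9 * (r - 2 - (-1) ^ k * (t * ϖ ^ k + t ^ 2 * conj ϖ ^ k)),
    2 * (r - 1) / 9 * (r + 1 - (-1) ^ k * (ϖ ^ k + conj ϖ ^ k)),
    r - 1,
    r - 1,
    r - 1,
    1]

/-- The weights when `3 ∤ (q - 1) / h`; `x`, `y`, `z` stand for
the periods `η_1`, `η_α`, `η_{α²}`. -/
def weightsB (h q r x y z : ℂ) : Fin 14 → ℂ :=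
  ![3 * h / q * x,
    3 * h / q * y,
    3 * h / q * z,
    h / q * (2 * x + y),
    h / q * (2 * x + z),
    h / q * (2 * y + x),
    h / q * (2 * y + z),
    h / q * (2 * z + x),
    h / q * (2 * z + y),
    -(h / q),
    h / q * ((r - 1) / 3 + x + y),
    h / q * ((r - 1) / 3 + x + z),
    h / q * ((r - 1) / 3 + y + z),
    h * (r - 1) / q]

/-- The frequencies when `3 ∤ (q - 1) / h`; `k` stands for `m s`, `t` for `ρ(α)`. -/
def freqsB (r : ℂ) (k : ℕ) (ϖ t : ℂ) : Fin 14 → ℂ :=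
  ![(r - 1) / 27 * (r + 1 - (-1) ^ k * (ϖ ^ k + conj ϖ ^ k)),
    (r - 1) / 27 * (r + 1 - (-1) ^ k * (ϖ ^ k + conj ϖ ^ k)),
    (r - 1) / 27 * (r + 1 - (-1) ^ k * (ϖ ^ k + conj ϖ ^ k)),
    (r - 1) / 9 * (r - 2 - (-1) ^ k * (t ^ 2 * ϖ ^ k + t * conj ϖ ^ k)),
    (r - 1) / 9 * (r - 2 - (-1) ^ k * (t * ϖ ^ k + t ^ 2 * conj ϖ ^ k)),
    (r - 1) / 9 * (r - 2 - (-1) ^ k * (t * ϖ ^ k + t ^ 2 * conj ϖ ^ k)),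
    (r - 1) / 9 * (r - 2 - (-1) ^ k * (t ^ 2 * ϖ ^ k + t * conj ϖ ^ k)),
    (r - 1) / 9 * (r - 2 - (-1) ^ k * (t ^ 2 * ϖ ^ k + t * conj ϖ ^ k)),
    (r - 1) / 9 * (r - 2 - (-1) ^ k * (t * ϖ ^ k + t ^ 2 * conj ϖ ^ k)),
    (r - 1) / 9 * (2 * r - 7 - 2 * (-1) ^ k * (ϖ ^ k + conj ϖ ^ k)),
    r - 1,
    r - 1,
    r - 1,
    1]

end CyclicCode

end

/-!
Write `ρ` for the cubic character of `F = 𝔽_r` attached to `ϖ` and `G` for its Gauss sum.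

*The weight.* By orthogonality of the additive characters of `K = 𝔽_q`, the number of zeros of a
codeword is a sum of `ψ(y x_i)` over `y ∈ K` and the positions `i`. As `β` has order three, the
positions split by `i mod 3`, and since `N = 3` the products `y (g ^ 3) ^ k` with `y ≠ 0` run
through the cubes of `F` evenly. So each of the three parts is a Gaussian period, and the modified
weight is `h / q` times the sum of the periods at `v_l = (a + β ^ l b) g ^ l` for `l = 1, 2, 3`
(`hammingNorm_codeword_eq`, `modifiedWeight_eq`).

*The periods.* On nonzero arguments of class `ρ(u) = y` the period is `(y ^ 2 G + y (conj G) - 1)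
/ 3`. The Davenport–Hasse relation (`sum_norm_trace_eq_gaussSum_pow`) expresses `G` by the Gauss
sum over `𝔽_p`, whose cube is `p` times a Jacobi sum. That Jacobi sum is primary over `p`, and it
is `ϖ` itself because it reduces to zero modulo `ϖ` (`exists_cubicResidueChar`,
`exists_mulChar_eq_rho`). As the degree of `F` over `𝔽_p` is divisible by three, this determines
`G`, not only `G ^ 3`.

*The distribution.* As `1, β, β ^ 2` are distinct with sum zero, `(a, b) ↦ (v_1, v_2, v_3)` is a
bijection onto the plane given by one linear equation, with coefficients of classes `ρ(g) ^ 2`,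
`ρ(g)`, `1`. The number of solutions with each `v_l` zero or in a given coset of the cubes is, by
orthogonality, an average of products of three periods (`card_filter_linear_eq`), which is a
polynomial in `r` and the cubes of `G` and `conj G` (`solutionCount_eq_closedCount`). Adding these
numbers over the classes that belong to one row of the table gives the frequencies
(`sum_closedCount_eq_freqsA`, `sum_closedCount_eq_freqsB`). Finally a nonzero pair `(a, b)` has a
nonzero codeword, since a period at a nonzero argument is smaller in absolute value than `(r - 1)
/ 3` (`codeword_injective`); so the distribution over the pairs is that over the codewords.
-/

noncomputable section

namespace CyclicCode

/-! ### The Davenport–Hasse relation -/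

section DavenportHasse

open Polynomial UniqueFactorizationMonoid

variable {k : Type*} [Field k] {R : Type*} [CommRing R]

/-- The function on monic polynomials that takes the value `χ (N x) ψ (Tr x)` on the
characteristic polynomial of `x`; it is completely multiplicative. -/
def polyChar (χ : MulChar k R) (ψ : AddChar k R) (f : k[X]) : R :=
  χ ((-1) ^ f.natDegree * f.coeff 0) * ψ (-f.nextCoeff)

variable (χ : MulChar k R) (ψ : AddChar k R)

lemma polyChar_one : polyChar χ ψ 1 = 1 := by
  simp [polyChar, nextCoeff]

lemma polyChar_mul {f g : k[X]} (hf : f.Monic) (hg : g.Monic) :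
    polyChar χ ψ (f * g) = polyChar χ ψ f * polyChar χ ψ g := by
  simp only [polyChar, hf.natDegree_mul hg, hf.nextCoeff_mul hg, mul_coeff_zero, neg_add,
    AddChar.map_add_eq_mul]
  rw [mul_mul_mul_comm, ← map_mul χ]
  congr 2
  ring

lemma polyChar_pow {f : k[X]} (hf : f.Monic) (j : ℕ) :
    polyChar χ ψ (f ^ j) = polyChar χ ψ f ^ j := by
  induction j with
  | zero => simp [polyChar_one]
  | succ j ih => rw [pow_succ, polyChar_mul χ ψ (hf.pow j) hf, ih, pow_succ]

lemma polyChar_minpoly_pow {L : Type*} [Field L] [Algebra k L] [FiniteDimensional k L]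
    (x : L) :
    polyChar χ ψ (minpoly k x) ^ (Module.finrank k L / (minpoly k x).natDegree) =
      χ (Algebra.norm k x) * ψ (Algebra.trace k L x) := by
  have hx : IsIntegral k x := Algebra.IsIntegral.isIntegral x
  have hdeg : Module.finrank k L / (minpoly k x).natDegree =
      Module.finrank (IntermediateField.adjoin k {x}) L := by
    rw [← IntermediateField.adjoin.finrank hx,
      ← Module.finrank_mul_finrank k (IntermediateField.adjoin k {x}) L,
      Nat.mul_div_cancel_left _ Module.finrank_pos]
  have hmin := IntermediateField.minpoly_gen k x
  have htr : Algebra.trace k _ (IntermediateField.AdjoinSimple.gen k x) =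
      -(minpoly k x).nextCoeff := by
    have := PowerBasis.trace_gen_eq_nextCoeff_minpoly (IntermediateField.adjoin.powerBasis hx)
    rwa [IntermediateField.adjoin.powerBasis_gen, hmin] at this
  have hno : Algebra.norm k (IntermediateField.AdjoinSimple.gen k x) =
      (-1) ^ (minpoly k x).natDegree * (minpoly k x).coeff 0 := by
    have := Algebra.PowerBasis.norm_gen_eq_coeff_zero_minpoly
      (IntermediateField.adjoin.powerBasis hx)
    rwa [IntermediateField.adjoin.powerBasis_gen, hmin,
      IntermediateField.adjoin.powerBasis_dim] at this
  rw [hdeg, Algebra.norm_eq_norm_adjoin, trace_eq_trace_adjoin, AddChar.map_nsmul_eq_pow, map_pow,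
    htr, hno, ← mul_pow, polyChar]

variable [Finite k]

lemma finite_monic_natDegree_eq (k : Type*) [Field k] [Finite k] (n : ℕ) :
    {f : k[X] | f.Monic ∧ f.natDegree = n}.Finite := by
  exact Set.finite_coe_iff.mp
    (Finite.of_equiv _ ((monicEquivDegreeLT n).trans (degreeLTEquiv k n).toEquiv).symm)

/-- The finite set of monic polynomials of degree `n` over a finite field. -/
def monicOfDegree (k : Type*) [Field k] [Finite k] (n : ℕ) : Finset k[X] :=
  (finite_monic_natDegree_eq k n).toFinset

@[simp] lemma mem_monicOfDegree {n : ℕ} {f : k[X]} :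
    f ∈ monicOfDegree k n ↔ f.Monic ∧ f.natDegree = n := by
  simp [monicOfDegree]

/-- The `n`-th coefficient of the `L`-series of `polyChar χ ψ`. -/
def polyCharSum (n : ℕ) : R := ∑ f ∈ monicOfDegree k n, polyChar χ ψ f

lemma polyCharSum_zero : polyCharSum χ ψ 0 = 1 := by
  have : monicOfDegree k 0 = {1} := by
    ext f
    simp only [mem_monicOfDegree, Finset.mem_singleton]
    constructor
    · rintro ⟨h1, h2⟩
      exact h1.natDegree_eq_zero.mp h2
    · rintro rfl
      simp [monic_one]
  simp [polyCharSum, this, polyChar_one]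

lemma polyCharSum_one [Fintype k] : polyCharSum χ ψ 1 = gaussSum χ ψ := by
  rw [polyCharSum, gaussSum]
  symm
  refine Finset.sum_bij (fun a _ => X - C a) (fun a _ => ?_) (fun a _ b _ hab => ?_)
    (fun f hf => ?_) (fun a _ => ?_)
  · simp [monic_X_sub_C]
  · simpa using hab
  · rw [mem_monicOfDegree] at hf
    refine ⟨-f.coeff 0, Finset.mem_univ _, ?_⟩
    rw [hf.1.eq_X_add_C hf.2]
    simp
  · simp [polyChar, nextCoeff_X_sub_C]

/-- Changing the second highest coefficient does not change the constant one, so the `L`-series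
is a polynomial of degree at most one. -/
lemma polyCharSum_eq_zero [IsDomain R] {ψ : AddChar k R} (hψ : ψ ≠ 1) {n : ℕ} (hn : 2 ≤ n) :
    polyCharSum χ ψ n = 0 := by
  obtain ⟨c, hc⟩ : ∃ c, ψ c ≠ 1 := by
    by_contra! h
    exact hψ (by ext c; simp [h c])
  have hdeg (c : k) {f : k[X]} (hf : f.Monic ∧ f.natDegree = n) :
      (f + C c * X ^ (n - 1)).Monic ∧ (f + C c * X ^ (n - 1)).natDegree = n := by
    have hlt : (C c * X ^ (n - 1) : k[X]).degree < f.degree := by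
      refine (degree_C_mul_X_pow_le _ _).trans_lt ?_
      rw [degree_eq_natDegree hf.1.ne_zero, hf.2]
      exact_mod_cast (by omega : n - 1 < n)
    exact ⟨hf.1.add_of_left hlt, by rw [natDegree_add_eq_left_of_degree_lt hlt, hf.2]⟩
  have hval (c : k) {f : k[X]} (hf : f.Monic ∧ f.natDegree = n) :
      polyChar χ ψ (f + C c * X ^ (n - 1)) = polyChar χ ψ f * ψ (-c) := by
    have h1 : (f + C c * X ^ (n - 1)).nextCoeff = f.nextCoeff + c := by
      rw [nextCoeff_of_natDegree_pos (by rw [(hdeg c hf).2]; omega),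
        nextCoeff_of_natDegree_pos (by rw [hf.2]; omega), (hdeg c hf).2, hf.2]
      simp
    have h2 : (f + C c * X ^ (n - 1)).coeff 0 = f.coeff 0 := by
      rw [coeff_add, coeff_C_mul, coeff_X_pow, if_neg (by omega)]
      simp
    rw [polyChar, polyChar, h1, h2, (hdeg c hf).2, hf.2, neg_add, AddChar.map_add_eq_mul, mul_assoc]
  have key : polyCharSum χ ψ n = polyCharSum χ ψ n * ψ c := by
    rw [polyCharSum, Finset.sum_mul]
    refine Finset.sum_bij' (fun f _ => f + C c * X ^ (n - 1))
      (fun f _ => f + C (-c) * X ^ (n - 1)) (fun f hf => ?_) (fun f hf => ?_) (fun f _ => ?_)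
      (fun f _ => ?_) (fun f hf => ?_)
    · exact mem_monicOfDegree.mpr (hdeg c (mem_monicOfDegree.mp hf))
    · exact mem_monicOfDegree.mpr (hdeg (-c) (mem_monicOfDegree.mp hf))
    · simp
    · simp
    · rw [hval c (mem_monicOfDegree.mp hf), mul_assoc, ← AddChar.map_add_eq_mul]
      simp
  have : polyCharSum χ ψ n * (ψ c - 1) = 0 := by rw [mul_sub, ← key]; ring
  exact (mul_eq_zero.mp this).resolve_right (sub_ne_zero.mpr hc)

open Classical in
/-- The finite set of monic irreducible polynomials of degree `d`. -/
def irredOfDegree (k : Type*) [Field k] [Finite k] (d : ℕ) : Finset k[X] :=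
  (monicOfDegree k d).filter Irreducible

@[simp] lemma mem_irredOfDegree {d : ℕ} {f : k[X]} :
    f ∈ irredOfDegree k d ↔ (f.Monic ∧ f.natDegree = d) ∧ Irreducible f := by
  simp [irredOfDegree]

open Classical in
/-- The degree is the sum of the degrees of the prime powers dividing the polynomial. -/
lemma natDegree_eq_sum_irred {n : ℕ} {f : k[X]} (hf : f ∈ monicOfDegree k n) :
    n = ∑ d ∈ Finset.Icc 1 n, ∑ P ∈ irredOfDegree k d, ∑ j ∈ Finset.Icc 1 n,
      if P ^ j ∣ f then d else 0 := by
  rw [mem_monicOfDegree] at hf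
  obtain ⟨hm, hn⟩ := hf
  have hf0 := hm.ne_zero
  have hmon : ∀ P ∈ normalizedFactors f, P.Monic := fun P hP => by
    have h0 := (irreducible_of_normalized_factor P hP).ne_zero
    rw [← normalize_normalized_factor P hP]
    exact monic_normalize h0
  have hprod : (normalizedFactors f).prod = f := by
    have h1 : (normalizedFactors f).prod.Monic := by
      simpa using monic_multiset_prod_of_monic (normalizedFactors f) id hmon
    exact eq_of_monic_of_associated h1 hm (prod_normalizedFactors hf0)
  have hcount : ∀ P : k[X], P.Monic → Irreducible P →
      ∑ j ∈ Finset.Icc 1 n, (if P ^ j ∣ f then P.natDegree else 0) =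
        (normalizedFactors f).count P * P.natDegree := by
    intro P hP hirr
    have hdvd : ∀ j, P ^ j ∣ f ↔ j ≤ (normalizedFactors f).count P := fun j => by
      rw [pow_dvd_iff_le_emultiplicity, emultiplicity_eq_count_normalizedFactors hirr hf0,
        hP.normalize_eq_self]
      exact Nat.cast_le
    have hle : (normalizedFactors f).count P ≤ n := by
      have h1 := natDegree_le_of_dvd ((hdvd _).mpr le_rfl) hf0
      rw [hP.natDegree_pow, hn] at h1
      exact le_trans (Nat.le_mul_of_pos_right _ hirr.natDegree_pos) h1
    rw [← Finset.sum_filter, Finset.sum_const, smul_eq_mul]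
    congr 1
    rw [show Finset.filter (fun j => P ^ j ∣ f) (Finset.Icc 1 n) =
      Finset.Icc 1 ((normalizedFactors f).count P) by
        ext j; simp only [Finset.mem_filter, Finset.mem_Icc, hdvd]; omega]
    simp
  have h1 : ∑ d ∈ Finset.Icc 1 n, ∑ P ∈ irredOfDegree k d, ∑ j ∈ Finset.Icc 1 n,
      (if P ^ j ∣ f then d else 0) =
      ∑ d ∈ Finset.Icc 1 n, ∑ P ∈ irredOfDegree k d,
        (normalizedFactors f).count P * P.natDegree := by
    refine Finset.sum_congr rfl fun d _ => Finset.sum_congr rfl fun P hP => ?_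
    rw [mem_irredOfDegree] at hP
    rw [← hcount P hP.1.1 hP.2, hP.1.2]
  have hdisj : ((Finset.Icc 1 n : Finset ℕ) : Set ℕ).PairwiseDisjoint (irredOfDegree k) := by
    intro a _ b _ hab
    refine Finset.disjoint_left.mpr fun P h1 h2 => hab ?_
    rw [mem_irredOfDegree] at h1 h2
    rw [← h1.1.2, h2.1.2]
  rw [h1, ← Finset.sum_biUnion hdisj]
  have hsub : (normalizedFactors f).toFinset ⊆ (Finset.Icc 1 n).biUnion (irredOfDegree k) := by
    intro P hP
    rw [Multiset.mem_toFinset] at hP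
    have hirr := irreducible_of_normalized_factor P hP
    rw [Finset.mem_biUnion]
    refine ⟨P.natDegree, Finset.mem_Icc.mpr ⟨hirr.natDegree_pos, ?_⟩, ?_⟩
    · rw [← hn]
      exact natDegree_le_of_dvd (dvd_of_mem_normalizedFactors hP) hf0
    · exact mem_irredOfDegree.mpr ⟨⟨hmon P hP, rfl⟩, hirr⟩
  rw [← Finset.sum_subset hsub fun P _ hP => by
    rw [Multiset.mem_toFinset] at hP
    rw [Multiset.count_eq_zero_of_notMem hP, zero_mul]]
  conv_lhs => rw [← hn, ← hprod, natDegree_multiset_prod_of_monic _ hmon,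
    Finset.sum_multiset_map_count]
  simp only [smul_eq_mul]

open Classical in
/-- The monic multiples of `P ^ j` of degree `n` are the `P ^ j * g` with `g` monic. -/
lemma sum_polyChar_of_pow_dvd {P : k[X]} (hP : P.Monic) (n j : ℕ) :
    ∑ f ∈ monicOfDegree k n, (if P ^ j ∣ f then polyChar χ ψ f else 0) =
      if j * P.natDegree ≤ n then
        polyChar χ ψ P ^ j * polyCharSum χ ψ (n - j * P.natDegree) else 0 := by
  split_ifs with h
  · rw [← Finset.sum_filter, polyCharSum, Finset.mul_sum]
    symm
    refine Finset.sum_bij (fun g _ => P ^ j * g) (fun g hg => ?_) (fun g _ g' _ hgg => ?_)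
      (fun f hf => ?_) (fun g hg => ?_)
    · rw [mem_monicOfDegree] at hg
      rw [Finset.mem_filter, mem_monicOfDegree]
      refine ⟨⟨(hP.pow j).mul hg.1, ?_⟩, dvd_mul_right _ _⟩
      rw [(hP.pow j).natDegree_mul hg.1, hP.natDegree_pow, hg.2]
      omega
    · exact mul_left_cancel₀ (hP.pow j).ne_zero hgg
    · rw [Finset.mem_filter, mem_monicOfDegree] at hf
      obtain ⟨⟨hm, hn⟩, g, rfl⟩ := hf
      have hg : g.Monic := (hP.pow j).of_mul_monic_left hm
      refine ⟨g, ?_, rfl⟩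
      rw [(hP.pow j).natDegree_mul hg, hP.natDegree_pow] at hn
      rw [mem_monicOfDegree]
      exact ⟨hg, by omega⟩
    · rw [polyChar_mul χ ψ (hP.pow j) (mem_monicOfDegree.mp hg).1, polyChar_pow χ ψ hP]
  · refine Finset.sum_eq_zero fun f hf => if_neg fun hd => h ?_
    rw [mem_monicOfDegree] at hf
    have h1 := natDegree_le_of_dvd hd hf.1.ne_zero
    rwa [hP.natDegree_pow, hf.2] at h1

/-- The `n`-th power sum attached to the Euler product of `polyChar χ ψ`: the sum of
`d * polyChar P ^ j` over the monic irreducible `P` of degree `d` with `j * d = n`. -/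
def primePowerSum (n : ℕ) : R :=
  ∑ d ∈ n.divisors, ∑ P ∈ irredOfDegree k d, (d : R) * polyChar χ ψ P ^ (n / d)

lemma primePowerSum_eq {n N : ℕ} (hn : n ≠ 0) (hN : n ≤ N) :
    primePowerSum χ ψ n = ∑ d ∈ Finset.Icc 1 N, ∑ P ∈ irredOfDegree k d, ∑ j ∈ Finset.Icc 1 N,
      if j * d = n then (d : R) * polyChar χ ψ P ^ j else 0 := by
  have hsub : n.divisors ⊆ Finset.Icc 1 N := fun d hd => by
    have := Nat.divisor_le hd
    have := Nat.pos_of_mem_divisors hd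
    rw [Finset.mem_Icc]
    omega
  rw [primePowerSum, ← Finset.sum_subset hsub]
  · refine Finset.sum_congr rfl fun d hd => Finset.sum_congr rfl fun P _ => ?_
    have hdn := Nat.dvd_of_mem_divisors hd
    have hd0 := Nat.pos_of_mem_divisors hd
    rw [Finset.sum_eq_single (n / d)]
    · rw [if_pos (Nat.div_mul_cancel hdn)]
    · intro j _ hj
      refine if_neg fun h => hj ?_
      rw [← h, Nat.mul_div_cancel _ hd0]
    · intro h
      exact absurd (Finset.mem_Icc.mpr ⟨Nat.div_pos (Nat.le_of_dvd (by omega) hdn) hd0,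
        (Nat.div_le_self _ _).trans hN⟩) h
  · intro d _ hd
    refine Finset.sum_eq_zero fun P _ => Finset.sum_eq_zero fun j _ => if_neg fun h => hd ?_
    exact Nat.mem_divisors.mpr ⟨⟨j, by rw [← h, mul_comm]⟩, hn⟩

/-- The logarithmic derivative of the Euler product, coefficientwise. -/
lemma natCast_mul_polyCharSum (n : ℕ) :
    (n : R) * polyCharSum χ ψ n = ∑ d ∈ Finset.Icc 1 n, ∑ P ∈ irredOfDegree k d,
      ∑ j ∈ Finset.Icc 1 n, if j * d ≤ n then
        (d : R) * polyChar χ ψ P ^ j * polyCharSum χ ψ (n - j * d) else 0 := by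
  classical
  have h1 : (n : R) * polyCharSum χ ψ n = ∑ f ∈ monicOfDegree k n, ∑ d ∈ Finset.Icc 1 n,
      ∑ P ∈ irredOfDegree k d, ∑ j ∈ Finset.Icc 1 n,
        if P ^ j ∣ f then (d : R) * polyChar χ ψ f else 0 := by
    rw [polyCharSum, Finset.mul_sum]
    refine Finset.sum_congr rfl fun f hf => ?_
    conv_lhs => rw [natDegree_eq_sum_irred hf]
    push_cast
    simp only [Finset.sum_mul, ite_mul, zero_mul]
  rw [h1, Finset.sum_comm]
  refine Finset.sum_congr rfl fun d _ => ?_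
  rw [Finset.sum_comm]
  refine Finset.sum_congr rfl fun P hP => ?_
  rw [Finset.sum_comm]
  refine Finset.sum_congr rfl fun j _ => ?_
  rw [mem_irredOfDegree] at hP
  have h2 := sum_polyChar_of_pow_dvd χ ψ hP.1.1 n j
  rw [hP.1.2] at h2
  rw [mul_assoc, ← mul_ite_zero, ← h2, Finset.mul_sum]
  simp only [mul_ite_zero]

lemma primePowerSum_one : primePowerSum χ ψ 1 = polyCharSum χ ψ 1 := by
  have := natCast_mul_polyCharSum χ ψ 1
  rw [Nat.cast_one, one_mul] at this
  rw [this, primePowerSum_eq χ ψ one_ne_zero le_rfl]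
  simp [polyCharSum_zero]

lemma primePowerSum_succ [IsDomain R] {ψ : AddChar k R} (hψ : ψ ≠ 1) {n : ℕ} (hn : 0 < n) :
    primePowerSum χ ψ (n + 1) = -(polyCharSum χ ψ 1 * primePowerSum χ ψ n) := by
  have h1 := natCast_mul_polyCharSum χ ψ (n + 1)
  rw [polyCharSum_eq_zero χ hψ (by omega), mul_zero] at h1
  rw [eq_neg_iff_add_eq_zero, h1, primePowerSum_eq χ ψ (Nat.succ_ne_zero n) le_rfl,
    primePowerSum_eq χ ψ hn.ne' (Nat.le_succ n), Finset.mul_sum, ← Finset.sum_add_distrib]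
  refine Finset.sum_congr rfl fun d _ => ?_
  rw [Finset.mul_sum, ← Finset.sum_add_distrib]
  refine Finset.sum_congr rfl fun P _ => ?_
  rw [Finset.mul_sum, ← Finset.sum_add_distrib]
  refine Finset.sum_congr rfl fun j _ => ?_
  rcases lt_trichotomy (j * d) n with h | h | h
  · rw [if_neg (by omega), if_neg (by omega), if_pos (by omega),
      polyCharSum_eq_zero χ hψ (n := n + 1 - j * d) (by omega)]
    ring
  · rw [if_neg (by omega), if_pos h, if_pos (by omega), h, Nat.add_sub_cancel_left]
    ring
  · rcases eq_or_ne (j * d) (n + 1) with h' | h'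
    · rw [if_pos h', if_neg (by omega), if_pos (by omega), h', Nat.sub_self, polyCharSum_zero]
      ring
    · rw [if_neg h', if_neg (by omega), if_neg (by omega)]
      ring

lemma primePowerSum_eq_pow [IsDomain R] {ψ : AddChar k R} (hψ : ψ ≠ 1) {n : ℕ} (hn : 0 < n) :
    primePowerSum χ ψ n = (-1) ^ (n + 1) * polyCharSum χ ψ 1 ^ n := by
  induction n, hn using Nat.le_induction with
  | base => rw [primePowerSum_one]; ring
  | succ n hn ih => rw [primePowerSum_succ χ hψ hn, ih]; ring

variable {L : Type*} [Field L] [Algebra k L] [Finite L]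

open Classical in
/-- An irreducible polynomial whose degree divides that of `L / k` has as many roots in `L` as its
degree says. -/
lemma card_filter_minpoly_eq [Fintype L] {P : k[X]} (hP : P.Monic) (hirr : Irreducible P)
    (hd : P.natDegree ∣ Module.finrank k L) :
    (Finset.univ.filter fun x : L => minpoly k x = P).card = P.natDegree := by
  have hcard : Nat.card k ^ Module.finrank k L = Fintype.card L := by
    rw [← Module.natCard_eq_pow_finrank, Nat.card_eq_fintype_card]
  have hdvd := (hirr.natDegree_dvd_iff_dvd_X_pow_card_pow_sub_X).mp hd
  rw [hcard] at hdvd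
  have hdvd' : P.map (algebraMap k L) ∣ X ^ Fintype.card L - X := by
    simpa using map_dvd (algebraMap k L) hdvd
  have h0 : (X ^ Fintype.card L - X : L[X]) ≠ 0 :=
    FiniteField.X_pow_card_sub_X_ne_zero L Fintype.one_lt_card
  have hroots := FiniteField.roots_X_pow_card_sub_X L
  have hsplit : (X ^ Fintype.card L - X : L[X]).Splits := by
    rw [splits_iff_card_roots, hroots, FiniteField.X_pow_card_sub_X_natDegree_eq L
      Fintype.one_lt_card]
    rfl
  have hs : (P.map (algebraMap k L)).Splits := hsplit.of_dvd h0 hdvd'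
  have hnodup : (P.map (algebraMap k L)).roots.Nodup := by
    refine Multiset.nodup_of_le (roots.le_of_dvd h0 hdvd') ?_
    rw [hroots]
    exact Finset.nodup _
  have hset : (Finset.univ.filter fun x : L => minpoly k x = P) =
      (P.map (algebraMap k L)).roots.toFinset := by
    ext x
    rw [Finset.mem_filter, Multiset.mem_toFinset, mem_roots_map hirr.ne_zero]
    constructor
    · rintro ⟨-, rfl⟩
      exact minpoly.aeval k x
    · intro h
      exact ⟨Finset.mem_univ _, (minpoly.eq_of_irreducible_of_monic hirr h hP).symm⟩
  rw [hset, Multiset.toFinset_card_of_nodup hnodup, splits_iff_card_roots.mp hs, natDegree_map]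

lemma sum_norm_trace_eq_primePowerSum [Fintype L] :
    ∑ x : L, χ (Algebra.norm k x) * ψ (Algebra.trace k L x) =
      primePowerSum χ ψ (Module.finrank k L) := by
  classical
  have hn : 0 < Module.finrank k L := Module.finrank_pos
  have hdisj : ((Module.finrank k L).divisors : Set ℕ).PairwiseDisjoint (irredOfDegree k) := by
    intro a _ b _ hab
    refine Finset.disjoint_left.mpr fun P h1 h2 => hab ?_
    rw [mem_irredOfDegree] at h1 h2
    rw [← h1.1.2, h2.1.2]
  have hmem : ∀ x : L, minpoly k x ∈ (Module.finrank k L).divisors.biUnion (irredOfDegree k) := by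
    intro x
    have hx : IsIntegral k x := Algebra.IsIntegral.isIntegral x
    rw [Finset.mem_biUnion]
    refine ⟨(minpoly k x).natDegree, Nat.mem_divisors.mpr ⟨minpoly.degree_dvd hx, hn.ne'⟩,
      mem_irredOfDegree.mpr ⟨⟨minpoly.monic hx, rfl⟩, minpoly.irreducible hx⟩⟩
  rw [primePowerSum, ← Finset.sum_fiberwise_of_maps_to (fun x _ => hmem x),
    Finset.sum_biUnion hdisj]
  refine Finset.sum_congr rfl fun d hd => Finset.sum_congr rfl fun P hP => ?_
  rw [mem_irredOfDegree] at hP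
  rw [Finset.sum_congr rfl (g := fun _ => polyChar χ ψ P ^ (Module.finrank k L / d))]
  · rw [Finset.sum_const, card_filter_minpoly_eq hP.1.1 hP.2
      (by rw [hP.1.2]; exact Nat.dvd_of_mem_divisors hd), hP.1.2, nsmul_eq_mul]
  · intro x hx
    rw [Finset.mem_filter] at hx
    rw [← polyChar_minpoly_pow, hx.2, hP.1.2]

/-- The **Davenport–Hasse relation**: the Gauss sum of the characters lifted to an extension along
norm and trace is, up to sign, a power of the original Gauss sum. -/
theorem sum_norm_trace_eq_gaussSum_pow [Fintype k] [Fintype L] [IsDomain R] {ψ : AddChar k R}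
    (hψ : ψ ≠ 1) :
    ∑ x : L, χ (Algebra.norm k x) * ψ (Algebra.trace k L x) =
      (-1) ^ (Module.finrank k L + 1) * gaussSum χ ψ ^ Module.finrank k L := by
  rw [sum_norm_trace_eq_primePowerSum, primePowerSum_eq_pow χ hψ Module.finrank_pos,
    polyCharSum_one]

end DavenportHasse

/-! ### Arithmetic of `ℤ[ω]` -/

lemma omega_sq_add_omega_add_one : omega ^ 2 + omega + 1 = 0 := by
  have h3 : (Real.sqrt 3 : ℂ) ^ 2 = 3 := by
    rw [← Complex.ofReal_pow, Real.sq_sqrt (by norm_num)]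
    norm_num
  rw [omega]
  linear_combination (1 / 4) * Complex.I ^ 2 * h3 + (3 / 4) * Complex.I_sq

/-- Roots of `X ^ 2 + X + 1` are the primitive cube roots of unity, away from characteristic `3`. -/
lemma isPrimitiveRoot_three_of_sq_add {R : Type*} [CommRing R] [IsDomain R] {z : R}
    (hz : z ^ 2 + z + 1 = 0) (h3 : (3 : R) ≠ 0) : IsPrimitiveRoot z 3 := by
  rw [IsPrimitiveRoot.iff_orderOf]
  refine orderOf_eq_prime (by linear_combination (z - 1) * hz) ?_
  rintro rfl
  exact h3 (by linear_combination hz)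

lemma isPrimitiveRoot_omega : IsPrimitiveRoot omega 3 :=
  isPrimitiveRoot_three_of_sq_add omega_sq_add_omega_add_one (by norm_num)

lemma conj_omega : conj omega = -1 - omega := by
  simp only [omega, map_div₀, map_add, map_neg, map_one, map_mul, Complex.conj_ofReal,
    Complex.conj_I, map_ofNat]
  ring

lemma omegaInt_sq_add : omegaInt ^ 2 + omegaInt + 1 = 0 :=
  Subtype.ext omega_sq_add_omega_add_one

lemma exists_eq_add_mul_omegaInt (x : ZOmega) : ∃ a b : ℤ, x = a + b * omegaInt := by
  obtain ⟨x, hx⟩ := x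
  induction hx using Algebra.adjoin_induction with
  | mem y hy =>
    refine ⟨0, 1, Subtype.ext ?_⟩
    simpa [omegaInt] using hy
  | algebraMap n =>
    refine ⟨n, 0, Subtype.ext ?_⟩
    simp
  | add y z hy hz h1 h2 =>
    obtain ⟨a, b, h1⟩ := h1
    obtain ⟨c, d, h2⟩ := h2
    refine ⟨a + c, b + d, ?_⟩
    rw [← AddMemClass.mk_add_mk _ y z hy hz, h1, h2]
    push_cast
    ring
  | mul y z hy hz h1 h2 =>
    obtain ⟨a, b, h1⟩ := h1
    obtain ⟨c, d, h2⟩ := h2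
    refine ⟨a * c - b * d, a * d + b * c - b * d, ?_⟩
    rw [← MulMemClass.mk_mul_mk _ y z hy hz, h1, h2]
    push_cast
    linear_combination (b * d : ZOmega) * omegaInt_sq_add

lemma mul_conj_eq (a b : ℤ) : ((a + b * omegaInt : ZOmega) : ℂ) *
    conj ((a + b * omegaInt : ZOmega) : ℂ) = ((a ^ 2 - a * b + b ^ 2 : ℤ) : ℂ) := by
  have h : ((a + b * omegaInt : ZOmega) : ℂ) = a + b * omega := by simp [omegaInt]
  rw [h]
  simp only [map_add, map_mul, map_intCast, conj_omega]
  push_cast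
  linear_combination (-b ^ 2 : ℂ) * omega_sq_add_omega_add_one

/-- `ℤ[ω]` is stable under complex conjugation. -/
lemma exists_coe_eq_conj (x : ZOmega) : ∃ y : ZOmega, (y : ℂ) = conj (x : ℂ) := by
  obtain ⟨a, b, rfl⟩ := exists_eq_add_mul_omegaInt x
  refine ⟨a - b - b * omegaInt, ?_⟩
  simp only [omegaInt, AddSubgroupClass.coe_sub, MulMemClass.coe_mul, AddMemClass.coe_add,
    SubringClass.coe_intCast, map_add, map_mul, map_intCast, conj_omega]
  ring

lemma exists_normSq_eq_natCast (x : ZOmega) : ∃ n : ℕ, Complex.normSq (x : ℂ) = n := by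
  obtain ⟨a, b, rfl⟩ := exists_eq_add_mul_omegaInt x
  have h := mul_conj_eq a b
  rw [Complex.mul_conj] at h
  have h' : Complex.normSq ((a + b * omegaInt : ZOmega) : ℂ) =
      ((a ^ 2 - a * b + b ^ 2 : ℤ) : ℝ) := by
    exact_mod_cast h
  have h0 : 0 ≤ a ^ 2 - a * b + b ^ 2 := by nlinarith [sq_nonneg (a - b), sq_nonneg (a + b)]
  refine ⟨(a ^ 2 - a * b + b ^ 2).toNat, ?_⟩
  rw [h', ← Int.cast_natCast, Int.toNat_of_nonneg h0]

section Primary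

variable {p : ℕ} {ϖ : ZOmega}

lemma IsPrimaryOver.normSq_eq (hϖ : IsPrimaryOver p ϖ) : Complex.normSq (ϖ : ℂ) = p := by
  have := hϖ.1
  rw [Complex.mul_conj] at this
  exact_mod_cast this

lemma IsPrimaryOver.eisensteinNorm_eq (hϖ : IsPrimaryOver p ϖ) : eisensteinNorm ϖ = p := by
  rw [eisensteinNorm, hϖ.normSq_eq, Nat.floor_natCast]

/-- The conjugate of an element of `ℤ[ω]` that is primary over `p` is primary over `p`. -/
lemma IsPrimaryOver.of_coe_eq_conj {ϖ' : ZOmega} (hϖ : IsPrimaryOver p ϖ)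
    (h : (ϖ' : ℂ) = conj (ϖ : ℂ)) : IsPrimaryOver p ϖ' := by
  refine ⟨by rw [h, Complex.conj_conj, mul_comm]; exact hϖ.1, ?_⟩
  obtain ⟨v, hv⟩ := hϖ.2
  obtain ⟨v', hv'⟩ := exists_coe_eq_conj v
  refine ⟨v', Subtype.ext ?_⟩
  have h1 := congrArg (fun x : ZOmega => conj (x : ℂ)) hv
  simp only [AddSubgroupClass.coe_sub, NegMemClass.coe_neg, OneMemClass.coe_one,
    MulMemClass.coe_mul, map_sub, map_neg, map_one, map_mul] at h1
  simp only [AddSubgroupClass.coe_sub, NegMemClass.coe_neg, OneMemClass.coe_one,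
    MulMemClass.coe_mul, h, hv', h1]
  congr 1
  exact map_ofNat (starRingEnd ℂ) 3

lemma IsPrimaryOver.dvd_natCast (hϖ : IsPrimaryOver p ϖ) : ϖ ∣ (p : ZOmega) := by
  obtain ⟨y, hy⟩ := exists_coe_eq_conj ϖ
  refine ⟨y, Subtype.ext ?_⟩
  rw [MulMemClass.coe_mul, hy, hϖ.1]
  simp

variable [Fact p.Prime]

/-- The only unit of `ℤ[ω]` congruent to `1` modulo `3` is `1`. -/
lemma IsPrimaryOver.eq_of_dvd {ϖ' : ZOmega} (hϖ : IsPrimaryOver p ϖ) (hϖ' : IsPrimaryOver p ϖ')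
    (h : ϖ ∣ ϖ') : ϖ' = ϖ := by
  obtain ⟨u, rfl⟩ := h
  have hp : (p : ℝ) ≠ 0 := by exact_mod_cast (Fact.out : p.Prime).ne_zero
  have hu : Complex.normSq (u : ℂ) = 1 := by
    have h1 := hϖ'.normSq_eq
    rw [MulMemClass.coe_mul, Complex.normSq_mul, hϖ.normSq_eq] at h1
    exact mul_left_cancel₀ hp (by rw [h1, mul_one])
  obtain ⟨v, hv⟩ : (3 : ZOmega) ∣ u - 1 := by
    have h1 := (hϖ.2.mul_right u).sub hϖ'.2
    have h2 : (ϖ - -1) * u - (ϖ * u - -1) = u - 1 := by ring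
    rwa [h2] at h1
  have hv' : (u : ℂ) - 1 = 3 * (v : ℂ) := by
    have h1 := congrArg (fun x : ZOmega => (x : ℂ)) hv
    simpa only [AddSubgroupClass.coe_sub, OneMemClass.coe_one, MulMemClass.coe_mul] using! h1
  obtain ⟨n, hn⟩ := exists_normSq_eq_natCast v
  -- `u = 1 + 3 v` is a unit, so `3 |v| ≤ |u| + 1 = 2`, and `|v| ^ 2` is an integer
  have h9 : 9 * Complex.normSq (v : ℂ) ≤ 4 := by
    have h1 : ‖(u : ℂ)‖ = 1 := by
      rw [Complex.normSq_eq_norm_sq] at hu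
      exact (pow_eq_one_iff_of_nonneg (norm_nonneg _) two_ne_zero).mp hu
    have h2 : ‖3 * (v : ℂ)‖ ≤ 2 := by
      rw [← hv']
      refine (norm_sub_le _ _).trans ?_
      rw [h1, norm_one]
      norm_num
    rw [norm_mul, Complex.norm_ofNat] at h2
    rw [Complex.normSq_eq_norm_sq]
    nlinarith [norm_nonneg (v : ℂ)]
  have hn0 : n = 0 := by
    rw [hn] at h9
    have : (9 * n : ℝ) < 9 := by linarith
    have : 9 * n < 9 := by exact_mod_cast this
    omega
  rw [hn0, Nat.cast_zero, Complex.normSq_eq_zero] at hn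
  have : u = 1 := by
    refine Subtype.ext ?_
    rw [hn, mul_zero, sub_eq_zero] at hv'
    simpa using hv'
  rw [this, mul_one]

lemma IsPrimaryOver.dvd_intCast_iff (hϖ : IsPrimaryOver p ϖ) (n : ℤ) :
    ϖ ∣ (n : ZOmega) ↔ (p : ℤ) ∣ n := by
  constructor
  · rintro ⟨y, hy⟩
    obtain ⟨m, hm⟩ := exists_normSq_eq_natCast y
    have h1 := congrArg (fun x : ZOmega => Complex.normSq (x : ℂ)) hy
    simp only [MulMemClass.coe_mul, Complex.normSq_mul, hϖ.normSq_eq, hm,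
      SubringClass.coe_intCast, Complex.normSq_intCast] at h1
    have h2 : n * n = p * m := by exact_mod_cast h1
    have h3 : (p : ℤ) ∣ n * n := ⟨m, h2⟩
    exact (or_self_iff.mp ((Nat.prime_iff_prime_int.mp Fact.out).dvd_or_dvd h3))
  · rintro ⟨m, rfl⟩
    push_cast
    exact hϖ.dvd_natCast.mul_right _

lemma IsPrimaryOver.intCast_surjective (hϖ : IsPrimaryOver p ϖ) :
    Function.Surjective (Int.castRingHom (ZOmega ⧸ Ideal.span {ϖ})) := by
  have hpp : p.Prime := Fact.out
  obtain ⟨a, b, hab⟩ := exists_eq_add_mul_omegaInt ϖ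
  have hnorm : a ^ 2 - a * b + b ^ 2 = p := by
    have := hϖ.1
    rw [hab, mul_conj_eq] at this
    exact_mod_cast this
  have hb : IsCoprime b (p : ℤ) := by
    rw [isCoprime_comm, (Nat.prime_iff_prime_int.mp hpp).coprime_iff_not_dvd]
    rintro ⟨c, rfl⟩
    have ha : (p : ℤ) ∣ a := by
      refine (Nat.prime_iff_prime_int.mp hpp).dvd_of_dvd_pow (n := 2) ⟨1 + a * c - p * c ^ 2, ?_⟩
      linear_combination hnorm
    obtain ⟨d, rfl⟩ := ha
    have h1 : (p : ℤ) * (p * (d ^ 2 - d * c + c ^ 2)) = p * 1 := by linear_combination hnorm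
    have h2 := mul_left_cancel₀ (by exact_mod_cast hpp.ne_zero) h1
    exact (Nat.prime_iff_prime_int.mp hpp).not_isUnit (IsUnit.of_mul_eq_one _ h2)
  obtain ⟨u, v, huv⟩ := hb
  intro x
  obtain ⟨x, rfl⟩ := Ideal.Quotient.mk_surjective x
  obtain ⟨c, d, rfl⟩ := exists_eq_add_mul_omegaInt x
  -- modulo `ϖ = a + b ω` and `p`, the relation `u b + v p = 1` gives `ω = - u a`
  refine ⟨c - d * u * a, ?_⟩
  rw [eq_intCast, ← map_intCast (Ideal.Quotient.mk (Ideal.span {ϖ})), Ideal.Quotient.eq,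
    Ideal.mem_span_singleton]
  have huv' : (u * b + v * p : ZOmega) = 1 := by
    exact_mod_cast congrArg (Int.cast (R := ZOmega)) huv
  have h1 : ((c - d * u * a : ℤ) : ZOmega) - (c + d * omegaInt) =
      -(d * u) * ϖ - d * v * omegaInt * p := by
    push_cast
    linear_combination (d * omegaInt : ZOmega) * huv' + (d * u : ZOmega) * hab
  rw [h1]
  exact (dvd_mul_left _ _).sub (hϖ.dvd_natCast.mul_left _)

theorem IsPrimaryOver.nonempty_quotient_equiv (hϖ : IsPrimaryOver p ϖ) :
    Nonempty ((ZOmega ⧸ Ideal.span {ϖ}) ≃+* ZMod p) := by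
  have hker : RingHom.ker (Int.castRingHom (ZOmega ⧸ Ideal.span {ϖ})) = Ideal.span {(p : ℤ)} := by
    ext n
    rw [RingHom.mem_ker, eq_intCast, ← map_intCast (Ideal.Quotient.mk (Ideal.span {ϖ})),
      Ideal.Quotient.eq_zero_iff_mem, Ideal.mem_span_singleton, Ideal.mem_span_singleton,
      hϖ.dvd_intCast_iff]
  exact ⟨((RingHom.quotientKerEquivOfSurjective hϖ.intCast_surjective).symm.trans
    (Ideal.quotEquivOfEq hker)).trans (Int.quotientSpanNatEquivZMod p)⟩

/-- Reduction modulo `ϖ`, as a ring homomorphism to `ZMod p`. -/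
lemma IsPrimaryOver.exists_reduction (hϖ : IsPrimaryOver p ϖ) :
    ∃ φ : ZOmega →+* ZMod p, ∀ x, φ x = 0 ↔ ϖ ∣ x := by
  obtain ⟨e⟩ := hϖ.nonempty_quotient_equiv
  refine ⟨e.toRingHom.comp (Ideal.Quotient.mk _), fun x => ?_⟩
  simp [Ideal.Quotient.eq_zero_iff_mem, Ideal.mem_span_singleton]

theorem IsPrimaryOver.iff_eq_or_conj {ϖ' : ZOmega} (hϖ : IsPrimaryOver p ϖ) :
    IsPrimaryOver p ϖ' ↔ ϖ' = ϖ ∨ (ϖ' : ℂ) = conj (ϖ : ℂ) := by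
  constructor
  · intro h
    obtain ⟨φ, hφ⟩ := hϖ.exists_reduction
    obtain ⟨y, hy⟩ := exists_coe_eq_conj ϖ'
    have hp : (p : ZOmega) = ϖ' * y := by
      refine Subtype.ext ?_
      rw [MulMemClass.coe_mul, hy, h.1]
      simp
    have h0 : φ ϖ' * φ y = 0 := by
      rw [← map_mul, ← hp, map_natCast, ZMod.natCast_self]
    rcases mul_eq_zero.mp h0 with h1 | h1
    · exact Or.inl (hϖ.eq_of_dvd h ((hφ _).mp h1))
    · right
      rw [← hϖ.eq_of_dvd (h.of_coe_eq_conj hy) ((hφ _).mp h1), hy, Complex.conj_conj]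
  · rintro (rfl | h)
    · exact hϖ
    · exact hϖ.of_coe_eq_conj h

end Primary

/-! ### Jacobi sums of cubic characters -/

section Jacobi

variable {p : ℕ} [Fact p.Prime]

/-- The Jacobi sum of a cubic character of `𝔽_p` is primary over `p`. -/
lemma exists_isPrimaryOver_eq_jacobiSum (hp : p % 3 = 1) {χ : MulChar (ZMod p) ℂ}
    (hχ : orderOf χ = 3) : ∃ ϖ : ZOmega, IsPrimaryOver p ϖ ∧ (ϖ : ℂ) = jacobiSum χ χ := by
  have hχ3 : χ ^ 3 = 1 := by rw [← hχ, pow_orderOf_eq_one]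
  have hχ1 : χ ≠ 1 := by rintro rfl; simp at hχ
  have hχ2 : χ * χ ≠ 1 := by
    intro h
    have : orderOf χ ∣ 2 := orderOf_dvd_of_pow_eq_one (by rw [pow_two, h])
    rw [hχ] at this
    omega
  obtain ⟨z, hz, hJ⟩ := exists_jacobiSum_eq_neg_one_add (n := 3) (by norm_num) hχ3 hχ3
    (by rw [ZMod.card]; omega) isPrimitiveRoot_omega
  refine ⟨-1 - 3 * omegaInt * ⟨z, hz⟩, ⟨?_, ?_⟩, ?_⟩
  rotate_left
  · exact ⟨-(omegaInt * ⟨z, hz⟩), by ring⟩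
  · rw [hJ]
    simp only [omegaInt, AddSubgroupClass.coe_sub, MulMemClass.coe_mul, NegMemClass.coe_neg,
      OneMemClass.coe_one]
    rw [show ((3 : ZOmega) : ℂ) = 3 from rfl]
    linear_combination (-z) * omega_sq_add_omega_add_one
  · have h1 : ((-1 - 3 * omegaInt * ⟨z, hz⟩ : ZOmega) : ℂ) = jacobiSum χ χ := by
      rw [hJ]
      simp only [omegaInt, AddSubgroupClass.coe_sub, MulMemClass.coe_mul, NegMemClass.coe_neg,
        OneMemClass.coe_one]
      rw [show ((3 : ZOmega) : ℂ) = 3 from rfl]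
      linear_combination (-z) * omega_sq_add_omega_add_one
    have h2 : conj (jacobiSum χ χ) = jacobiSum χ⁻¹ χ⁻¹ := by
      rw [← MulChar.star_eq_inv]
      simp [jacobiSum, MulChar.star_apply]
    rw [h1, h2, jacobiSum_mul_jacobiSum_inv _ hχ1 hχ1 hχ2, ZMod.card]
    rw [ZMod.ringChar_zmod_n, ringChar.eq_zero]
    exact (Fact.out : p.Prime).ne_zero.symm

theorem exists_isPrimaryOver (hp : p % 3 = 1) : ∃ ϖ : ZOmega, IsPrimaryOver p ϖ := by
  obtain ⟨χ, hχ⟩ := MulChar.exists_mulChar_orderOf (ZMod p) (n := 3)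
    (by rw [ZMod.card]; omega) isPrimitiveRoot_omega
  obtain ⟨ϖ, h, -⟩ := exists_isPrimaryOver_eq_jacobiSum hp hχ
  exact ⟨ϖ, h⟩

/-! ### The cubic residue character -/

/-- The cubic residue symbol of `x` corresponds to `x ^ ((p - 1) / 3)` under reduction modulo
`ϖ`. -/
lemma cubicResidueSymbol_eq_pow (hp : p % 3 = 1) {ϖ : ZOmega} (hϖ : IsPrimaryOver p ϖ)
    {φ : ZOmega →+* ZMod p} (hφ : ∀ x, φ x = 0 ↔ ϖ ∣ x) {x : ZMod p} (hx : x ≠ 0) {i : ℕ}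
    (hi : x ^ ((p - 1) / 3) = φ omegaInt ^ i) :
    cubicResidueSymbol (x.val : ZOmega) ϖ = omega ^ i := by
  have h3 : (3 : ZMod p) ≠ 0 := by
    intro h
    have h1 : (p : ℕ) ∣ 3 := (ZMod.natCast_eq_zero_iff 3 p).mp (by exact_mod_cast h)
    have := (Nat.prime_dvd_prime_iff_eq Fact.out Nat.prime_three).mp h1
    omega
  have hζ : IsPrimitiveRoot (φ omegaInt) 3 := by
    refine isPrimitiveRoot_three_of_sq_add ?_ h3
    have := congrArg φ omegaInt_sq_add
    simpa using this
  have hxφ : φ (x.val : ZOmega) = x := by rw [map_natCast, ZMod.natCast_zmod_val]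
  have key : ∀ y : ZOmega, ϖ ∣ (x.val : ZOmega) ^ ((eisensteinNorm ϖ - 1) / 3) - y ↔
      φ omegaInt ^ i = φ y := by
    intro y
    rw [← hφ, map_sub, map_pow, hxφ, hϖ.eisensteinNorm_eq, hi, sub_eq_zero]
  have hred : ∀ {M : Type} [CommMonoid M] {z : M}, IsPrimitiveRoot z 3 → z ^ i = z ^ (i % 3) :=
    fun hz => pow_eq_pow_mod i hz.pow_eq_one
  rw [cubicResidueSymbol, if_neg (by rwa [← hφ, hxφ]), key, key, key, map_one, map_pow,
    hred hζ, hred isPrimitiveRoot_omega]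
  have hne1 : φ omegaInt ≠ 1 := hζ.ne_one (by norm_num)
  have hne2 : φ omegaInt ^ 2 ≠ 1 := hζ.pow_ne_one_of_pos_of_lt (by norm_num) (by norm_num)
  have hne3 : φ omegaInt ^ 2 ≠ φ omegaInt := by
    intro h
    exact hne1 (mul_left_cancel₀ (hζ.ne_zero (by norm_num)) (by rw [← pow_two, h, mul_one]))
  have hlt : i % 3 < 3 := Nat.mod_lt _ (by norm_num)
  interval_cases i % 3
  · simp
  · simp [hne1]
  · simp [hne2, hne3]

lemma exists_pow_eq_pow_omega (hp : p % 3 = 1) (φ : ZOmega →+* ZMod p) {x : ZMod p}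
    (hx : x ≠ 0) : ∃ i : ℕ, x ^ ((p - 1) / 3) = φ omegaInt ^ i := by
  have h1 : (x ^ ((p - 1) / 3)) ^ 3 = 1 := by
    rw [← pow_mul, Nat.div_mul_cancel (by omega), ZMod.pow_card_sub_one_eq_one hx]
  have hω : φ omegaInt ^ 2 + φ omegaInt + 1 = 0 := by
    have := congrArg φ omegaInt_sq_add
    simpa using this
  set y := x ^ ((p - 1) / 3)
  have h2 : (y - 1) * ((y - φ omegaInt) * (y - φ omegaInt ^ 2)) = 0 := by
    linear_combination h1 + (y - y ^ 2 + (φ omegaInt - 1) * (y - 1)) * hω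
  rcases mul_eq_zero.mp h2 with h | h
  · exact ⟨0, by rw [pow_zero]; exact sub_eq_zero.mp h⟩
  · rcases mul_eq_zero.mp h with h | h
    · exact ⟨1, by rw [pow_one]; exact sub_eq_zero.mp h⟩
    · exact ⟨2, sub_eq_zero.mp h⟩

lemma cubicResidueSymbol_zero (ϖ : ZOmega) : cubicResidueSymbol 0 ϖ = 0 := by
  simp [cubicResidueSymbol]

/-- The cubic residue symbol modulo `ϖ` as a multiplicative character of `𝔽_p`. -/
lemma exists_cubicResidueChar (hp : p % 3 = 1) {ϖ : ZOmega} (hϖ : IsPrimaryOver p ϖ) :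
    ∃ χ : MulChar (ZMod p) ℂ, (∀ x : ZMod p, χ x = cubicResidueSymbol (x.val : ZOmega) ϖ) ∧
      orderOf χ = 3 ∧ jacobiSum χ χ = ϖ := by
  obtain ⟨φ, hφ⟩ := hϖ.exists_reduction
  have hpp : p.Prime := Fact.out
  have hp2 := hpp.two_le
  have hn0 : (p - 1) / 3 ≠ 0 := by omega
  let χ : MulChar (ZMod p) ℂ :=
    { toFun := fun x => cubicResidueSymbol (x.val : ZOmega) ϖ
      map_one' := by
        simpa using cubicResidueSymbol_eq_pow hp hϖ hφ (x := 1) one_ne_zero (i := 0) (by simp)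
      map_mul' := fun x y => by
        rcases eq_or_ne x 0 with rfl | hx
        · simp [cubicResidueSymbol_zero]
        rcases eq_or_ne y 0 with rfl | hy
        · simp [cubicResidueSymbol_zero]
        obtain ⟨i, hi⟩ := exists_pow_eq_pow_omega hp φ hx
        obtain ⟨j, hj⟩ := exists_pow_eq_pow_omega hp φ hy
        rw [cubicResidueSymbol_eq_pow hp hϖ hφ hx hi, cubicResidueSymbol_eq_pow hp hϖ hφ hy hj,
          cubicResidueSymbol_eq_pow hp hϖ hφ (mul_ne_zero hx hy) (i := i + j)
            (by rw [mul_pow, hi, hj, pow_add]), pow_add]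
      map_nonunit' := fun x hx => by
        rw [isUnit_iff_ne_zero, not_not] at hx
        simp [hx, cubicResidueSymbol_zero] }
  have hχ : ∀ x : ZMod p, χ x = cubicResidueSymbol (x.val : ZOmega) ϖ := fun _ => rfl
  have hval : ∀ x : ZMod p, ∃ y : ZOmega, (y : ℂ) = χ x ∧ φ y = x ^ ((p - 1) / 3) := by
    intro x
    rcases eq_or_ne x 0 with rfl | hx
    · exact ⟨0, by rw [MulChar.map_zero, ZeroMemClass.coe_zero], by simp [hn0]⟩
    · obtain ⟨i, hi⟩ := exists_pow_eq_pow_omega hp φ hx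
      exact ⟨omegaInt ^ i, by rw [hχ, cubicResidueSymbol_eq_pow hp hϖ hφ hx hi]; rfl,
        by rw [map_pow, hi]⟩
  have hord : orderOf χ = 3 := by
    refine orderOf_eq_prime ?_ ?_
    · ext x
      obtain ⟨i, hi⟩ := exists_pow_eq_pow_omega hp φ x.ne_zero
      rw [MulChar.pow_apply_coe, hχ, cubicResidueSymbol_eq_pow hp hϖ hφ x.ne_zero hi,
        MulChar.one_apply_coe, ← pow_mul, mul_comm, pow_mul, isPrimitiveRoot_omega.pow_eq_one,
        one_pow]
    · intro h1
      have hall : ∀ x : (ZMod p)ˣ, x ^ ((p - 1) / 3) = 1 := by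
        intro x
        obtain ⟨i, hi⟩ := exists_pow_eq_pow_omega hp φ x.ne_zero
        have h2 : χ x = 1 := by rw [h1, MulChar.one_apply_coe]
        rw [hχ, cubicResidueSymbol_eq_pow hp hϖ hφ x.ne_zero hi,
          isPrimitiveRoot_omega.pow_eq_one_iff_dvd] at h2
        obtain ⟨j, rfl⟩ := h2
        refine Units.ext ?_
        rw [Units.val_pow_eq_pow_val, hi, pow_mul, ← map_pow,
          show omegaInt ^ 3 = 1 from by linear_combination (omegaInt - 1) * omegaInt_sq_add]
        simp
      have h2 := (FiniteField.forall_pow_eq_one_iff (ZMod p) ((p - 1) / 3)).mp hall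
      rw [ZMod.card] at h2
      have := Nat.le_of_dvd (by omega) h2
      omega
  refine ⟨χ, hχ, hord, ?_⟩
  obtain ⟨ϖ', hϖ', hJ⟩ := exists_isPrimaryOver_eq_jacobiSum hp hord
  choose c hc hcφ using hval
  have hJ' : ϖ' = ∑ x : ZMod p, c x * c (1 - x) := by
    refine Subtype.ext ?_
    rw [hJ, jacobiSum, AddSubmonoidClass.coe_finsetSum]
    simp only [MulMemClass.coe_mul, hc]
  have h0 : φ ϖ' = 0 := by
    rw [hJ', map_sum]
    simp only [map_mul, hcφ]
    -- the polynomial `X ^ n (1 - X) ^ n` has degree `2 (p - 1) / 3 < p - 1`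
    have hexp : ∀ x : ZMod p, x ^ ((p - 1) / 3) * (1 - x) ^ ((p - 1) / 3) =
        ∑ j ∈ Finset.range ((p - 1) / 3 + 1),
          (-1) ^ j * ((p - 1) / 3).choose j * x ^ ((p - 1) / 3 + j) := by
      intro x
      rw [sub_eq_add_neg, add_comm, add_pow, Finset.mul_sum]
      refine Finset.sum_congr rfl fun j _ => ?_
      rw [one_pow, neg_pow, pow_add]
      ring
    rw [Finset.sum_congr rfl fun x _ => hexp x, Finset.sum_comm]
    refine Finset.sum_eq_zero fun j hj => ?_
    rw [Finset.mem_range] at hj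
    rw [← Finset.mul_sum, FiniteField.sum_pow_lt_card_sub_one (K := ZMod p), mul_zero]
    rw [ZMod.card]
    omega
  rw [← hJ, hϖ.eq_of_dvd hϖ' ((hφ _).mp h0)]

end Jacobi

/-! ### Gauss sums and periods of cubic characters -/

/-- The period of order three on a coset of the cubes on which the cubic character has the
value `y`, in terms of the Gauss sums `G` and `H` of the character and its inverse. -/
def cubicPeriod (G H y : ℂ) : ℂ := (y ^ 2 * G + y * H - 1) / 3

/-- The values of a cubic character with `ρ(α) = t` on the four classes `C₀ ∋ 1`, `C₁ ∋ α`,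
`C₂ ∋ α²` (the cosets of the cubes) and `{0}`. -/
def classValue (t : ℂ) : Fin 4 → ℂ := ![1, t, t ^ 2, 0]

/-- The sums of `ψ(v u)` over `v` in each of the four classes, where `ρ(u) = y`. -/
def classSum (G H t y : ℂ) : Fin 4 → ℂ :=
  ![cubicPeriod G H y, cubicPeriod G H (y * t), cubicPeriod G H (y * t ^ 2), 1]

/-- The sizes of the four classes. -/
def classSize (r : ℂ) : Fin 4 → ℂ := ![(r - 1) / 3, (r - 1) / 3, (r - 1) / 3, 1]

section CubicCharacter

variable {F : Type*} [Field F] {ρ : MulChar F ℂ}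

lemma apply_pow_three (hρ : orderOf ρ = 3) {x : F} (hx : x ≠ 0) : ρ x ^ 3 = 1 := by
  rw [← MulChar.pow_apply' ρ three_ne_zero, ← hρ, pow_orderOf_eq_one,
    MulChar.one_apply hx.isUnit]

lemma inv_apply_eq_sq (hρ : orderOf ρ = 3) (x : F) : ρ⁻¹ x = ρ x ^ 2 := by
  have h : ρ⁻¹ = ρ ^ 2 :=
    inv_eq_of_mul_eq_one_right (by rw [← pow_succ']; exact orderOf_dvd_iff_pow_eq_one.mp hρ.dvd)
  rw [h, MulChar.pow_apply' ρ two_ne_zero]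

lemma ne_one_of_orderOf_eq_three (hρ : orderOf ρ = 3) : ρ ≠ 1 := by
  rintro rfl
  simp at hρ

lemma apply_neg_one_eq_one (hρ : orderOf ρ = 3) : ρ (-1) = 1 := by
  have h := apply_pow_three hρ (x := (-1 : F)) (neg_ne_zero.mpr one_ne_zero)
  rwa [← map_pow, Odd.neg_one_pow (by decide)] at h

/-- The indicator function of a coset of the cubes, expanded in characters. -/
lemma indicator_eq (hρ : orderOf ρ = 3) {x : F} (hx : x ≠ 0) {y : ℂ} (hy : y ^ 3 = 1)
    [Decidable (ρ x = y)] :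
    (if ρ x = y then (1 : ℂ) else 0) = (1 + y ^ 2 * ρ x + y * ρ x ^ 2) / 3 := by
  have hx3 := apply_pow_three hρ hx
  split_ifs with h
  · rw [h]
    linear_combination (-2 / 3 : ℂ) * hy
  · have h1 : (ρ x - y) * (ρ x ^ 2 + ρ x * y + y ^ 2) = 0 := by linear_combination hx3 - hy
    have h2 := (mul_eq_zero.mp h1).resolve_left (sub_ne_zero.mpr h)
    linear_combination (-y / 3) * h2 + (1 / 3 : ℂ) * hy

variable {t : ℂ}

lemma eq_classValue (hρ : orderOf ρ = 3) (ht : t ^ 2 + t + 1 = 0) (x : F) :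
    ∃ i, ρ x = classValue t i := by
  rcases eq_or_ne x 0 with rfl | hx
  · exact ⟨3, by simp [classValue, MulChar.map_zero]⟩
  · have h1 : (ρ x - 1) * ((ρ x - t) * (ρ x - t ^ 2)) = 0 := by
      linear_combination apply_pow_three hρ hx +
        (ρ x - ρ x ^ 2 + (t - 1) * (ρ x - 1)) * ht
    rcases mul_eq_zero.mp h1 with h | h
    · exact ⟨0, sub_eq_zero.mp h⟩
    · rcases mul_eq_zero.mp h with h | h
      · exact ⟨1, sub_eq_zero.mp h⟩
      · exact ⟨2, sub_eq_zero.mp h⟩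

lemma classValue_injective (ht : t ^ 2 + t + 1 = 0) : Function.Injective (classValue t) := by
  have h := isPrimitiveRoot_three_of_sq_add ht (by norm_num)
  have h0 : t ≠ 0 := h.ne_zero (by norm_num)
  have h1 : t ≠ 1 := h.ne_one (by norm_num)
  have h2 : t ^ 2 ≠ 1 := h.pow_ne_one_of_pos_of_lt (by norm_num) (by norm_num)
  have h3 : t ^ 2 ≠ t := fun h' => h1 (mul_left_cancel₀ h0 (by rw [← pow_two, h', mul_one]))
  intro i j hij
  fin_cases i <;> fin_cases j <;>
    first
    | rfl
    | exact absurd hij (by simp [classValue, h0, h1, h2, h3, h1.symm, h2.symm, h3.symm, h0.symm,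
      (pow_ne_zero 2 h0).symm])

variable [Fintype F] {ψ : AddChar F ℂ}

lemma gaussSum_inv_eq_conj (hρ : orderOf ρ = 3) : gaussSum ρ⁻¹ ψ = conj (gaussSum ρ ψ) := by
  rw [starRingEnd_apply, star_gaussSum_eq, ← mul_gaussSum_inv_eq_gaussSum, inv_apply_eq_sq hρ,
    apply_neg_one_eq_one hρ, one_pow, one_mul]

lemma gaussSum_mul_gaussSum_inv (hρ : orderOf ρ = 3) (hψ : ψ.IsPrimitive) :
    gaussSum ρ ψ * gaussSum ρ⁻¹ ψ = Fintype.card F := by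
  rw [gaussSum_inv_eq_conj hρ, starRingEnd_apply, star_gaussSum_eq,
    gaussSum_mul_gaussSum_eq_card (ne_one_of_orderOf_eq_three hρ) hψ]

lemma norm_gaussSum_sq (hρ : orderOf ρ = 3) (hψ : ψ.IsPrimitive) :
    ‖gaussSum ρ ψ‖ ^ 2 = Fintype.card F := by
  have h := gaussSum_mul_gaussSum_inv hρ hψ
  rw [gaussSum_inv_eq_conj hρ, Complex.mul_conj, Complex.normSq_eq_norm_sq] at h
  exact_mod_cast h

lemma gaussSum_pow_three (hρ : orderOf ρ = 3) (hψ : ψ.IsPrimitive) :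
    gaussSum ρ ψ ^ 3 = Fintype.card F * jacobiSum ρ ρ := by
  have h := gaussSum_pow_eq_prod_jacobiSum (χ := ρ) (ψ := ψ) (by omega) hψ
  rw [hρ, apply_neg_one_eq_one hρ] at h
  simpa using h

open Classical in
/-- The additive character sums over the cosets of the cubes. -/
lemma sum_filter_eq_cubicPeriod (hρ : orderOf ρ = 3) (hψ : ψ.IsPrimitive) {y : ℂ}
    (hy : y ^ 3 = 1) {u : F} (hu : u ≠ 0) :
    ∑ v : F with ρ v = y, ψ (v * u) =
      cubicPeriod (gaussSum ρ ψ) (gaussSum ρ⁻¹ ψ) (ρ u * y) := by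
  have hy0 : y ≠ 0 := by rintro rfl; simp at hy
  have hu3 := apply_pow_three hρ hu
  have hshift : ∀ χ : MulChar F ℂ, ∑ v, χ v * ψ (v * u) = χ⁻¹ u * gaussSum χ ψ := fun χ => by
    rw [← Units.val_mk0 hu, ← gaussSum_mulShift_eq, gaussSum]
    simp [mul_comm]
  have h1 : ∀ v : F, (if ρ v = y then ψ (v * u) else 0) =
      (1 / 3) * (ψ (v * u) - (if v = 0 then 1 else 0) + y ^ 2 * (ρ v * ψ (v * u)) +
        y * (ρ⁻¹ v * ψ (v * u))) := by
    intro v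
    rcases eq_or_ne v 0 with rfl | hv
    · rw [if_neg (by rw [MulChar.map_zero]; exact hy0.symm)]
      simp [MulChar.map_zero]
    · rw [← mul_boole, indicator_eq hρ hv hy, if_neg hv, inv_apply_eq_sq hρ]
      ring
  rw [Finset.sum_filter, Finset.sum_congr rfl fun v _ => h1 v, ← Finset.mul_sum]
  simp only [Finset.sum_add_distrib, Finset.sum_sub_distrib, ← Finset.mul_sum, hshift]
  rw [AddChar.sum_mulShift u hψ, if_neg hu, inv_inv, inv_apply_eq_sq hρ, cubicPeriod]
  simp only [Finset.sum_ite_eq', Finset.mem_univ, if_true, Nat.cast_zero]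
  ring

open Classical in
lemma card_filter_apply_eq (hρ : orderOf ρ = 3) {y : ℂ} (hy : y ^ 3 = 1) :
    ((Finset.univ.filter fun v : F => ρ v = y).card : ℂ) = ((Fintype.card F : ℂ) - 1) / 3 := by
  have hy0 : y ≠ 0 := by rintro rfl; simp at hy
  have h1 : ∀ v : F, (if ρ v = y then (1 : ℂ) else 0) =
      (1 / 3) * (1 - (if v = 0 then 1 else 0) + y ^ 2 * ρ v + y * ρ⁻¹ v) := by
    intro v
    rcases eq_or_ne v 0 with rfl | hv
    · rw [if_neg (by rw [MulChar.map_zero]; exact hy0.symm)]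
      simp [MulChar.map_zero]
    · rw [indicator_eq hρ hv hy, if_neg hv, inv_apply_eq_sq hρ]
      ring
  have hne := ne_one_of_orderOf_eq_three hρ
  rw [Finset.card_filter, Nat.cast_sum]
  push_cast
  rw [Finset.sum_congr rfl fun v _ => h1 v, ← Finset.mul_sum]
  simp only [Finset.sum_add_distrib, Finset.sum_sub_distrib, ← Finset.mul_sum]
  rw [MulChar.sum_eq_zero_of_ne_one hne, MulChar.sum_eq_zero_of_ne_one (inv_ne_one.mpr hne)]
  simp only [Finset.sum_ite_eq', Finset.mem_univ, if_true, Finset.sum_const, Finset.card_univ,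
    nsmul_eq_mul]
  ring

open Classical in
lemma filter_apply_eq_zero (hρ : orderOf ρ = 3) :
    (Finset.univ.filter fun v : F => ρ v = 0) = {0} := by
  ext v
  rw [Finset.mem_filter, Finset.mem_singleton]
  constructor
  · rintro ⟨-, h⟩
    by_contra hv
    have := apply_pow_three hρ hv
    rw [h] at this
    norm_num at this
  · rintro rfl
    exact ⟨Finset.mem_univ _, ρ.map_zero⟩

open Classical in
lemma sum_filter_classValue (hρ : orderOf ρ = 3) (hψ : ψ.IsPrimitive)
    (ht : t ^ 2 + t + 1 = 0) {u : F} (hu : u ≠ 0) (i : Fin 4) :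
    ∑ v : F with ρ v = classValue t i, ψ (v * u) =
      classSum (gaussSum ρ ψ) (gaussSum ρ⁻¹ ψ) t (ρ u) i := by
  have ht3 : t ^ 3 = 1 := by linear_combination (t - 1) * ht
  have ht3' : (t ^ 2) ^ 3 = 1 := by rw [← pow_mul, mul_comm, pow_mul, ht3, one_pow]
  fin_cases i
  · exact (sum_filter_eq_cubicPeriod hρ hψ (one_pow 3) hu).trans (by rw [mul_one]; rfl)
  · exact sum_filter_eq_cubicPeriod hρ hψ ht3 hu
  · exact sum_filter_eq_cubicPeriod hρ hψ
      (ht3' : (t ^ 2) ^ 3 = 1) hu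
  · change ∑ v : F with ρ v = 0, ψ (v * u) = 1
    rw [filter_apply_eq_zero hρ]
    simp

open Classical in
lemma card_filter_classValue (hρ : orderOf ρ = 3) (ht : t ^ 2 + t + 1 = 0) (i : Fin 4) :
    ((Finset.univ.filter fun v : F => ρ v = classValue t i).card : ℂ) =
      classSize (Fintype.card F) i := by
  have ht3 : t ^ 3 = 1 := by linear_combination (t - 1) * ht
  have ht3' : (t ^ 2) ^ 3 = 1 := by rw [← pow_mul, mul_comm, pow_mul, ht3, one_pow]
  fin_cases i
  · exact card_filter_apply_eq hρ (one_pow 3)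
  · exact card_filter_apply_eq hρ ht3
  · exact card_filter_apply_eq hρ (ht3' : (t ^ 2) ^ 3 = 1)
  · change ((Finset.univ.filter fun v : F => ρ v = 0).card : ℂ) = 1
    rw [filter_apply_eq_zero hρ]
    simp

open Classical in
lemma sum_ne_zero_comp (hρ : orderOf ρ = 3) (ht : t ^ 2 + t + 1 = 0) (f : ℂ → ℂ) :
    ∑ u : F with u ≠ 0, f (ρ u) =
      ((Fintype.card F : ℂ) - 1) / 3 * (f 1 + f t + f (t ^ 2)) := by
  have h0 : ∀ u : F, u ≠ 0 ↔ ρ u ≠ 0 := fun u => by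
    rw [← isUnit_iff_ne_zero]
    exact ⟨fun h => (h.map ρ).ne_zero, fun h => by_contra fun h' => h (ρ.map_nonunit h')⟩
  choose κ hκ using fun x : F => eq_classValue hρ ht x
  have hinj := classValue_injective ht
  have hκ3 : ∀ u : F, u ≠ 0 ↔ κ u ≠ 3 := fun u => by
    rw [h0, hκ, ← hinj.ne_iff]
    simp [classValue]
  have hcard : ∀ i, ((Finset.univ.filter fun u : F => κ u = i).card : ℂ) =
      classSize (Fintype.card F) i := fun i => by
    rw [← card_filter_classValue hρ ht i]
    simp only [hκ, hinj.eq_iff]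
  rw [Finset.sum_filter, ← Finset.sum_fiberwise (g := κ)]
  have hfib : ∀ i, ∑ u : F with κ u = i, (if u ≠ 0 then f (ρ u) else 0) =
      classSize (Fintype.card F) i * (if i ≠ 3 then f (classValue t i) else 0) := fun i => by
    rw [← hcard, ← nsmul_eq_mul, ← Finset.sum_const]
    refine Finset.sum_congr rfl fun u hu => ?_
    rw [Finset.mem_filter] at hu
    simp only [hκ3, hκ u, hu.2]
  rw [Finset.sum_congr rfl fun i _ => hfib i, Fin.sum_univ_four]
  simp [classSize, classValue]
  ring

/-- The number of solutions of `c₁ v₁ + c₂ v₂ + c₃ v₃ = 0` with `v₁`, `v₂`, `v₃` in the classes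
`i`, `j`, `k`, where `y₁`, `y₂`, `y₃` are the values of the cubic character at `c₁`, `c₂`, `c₃`. -/
def solutionCount (r G H t y₁ y₂ y₃ : ℂ) (i j k : Fin 4) : ℂ :=
  (classSize r i * classSize r j * classSize r k + (r - 1) / 3 *
    (classSum G H t y₁ i * classSum G H t y₂ j * classSum G H t y₃ k +
      classSum G H t (t * y₁) i * classSum G H t (t * y₂) j * classSum G H t (t * y₃) k +
      classSum G H t (t ^ 2 * y₁) i * classSum G H t (t ^ 2 * y₂) j *
        classSum G H t (t ^ 2 * y₃) k)) / r

open Classical in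
/-- Solutions of a linear equation are counted by an additive character sum, which is constant on
the cosets of the cubes. -/
lemma card_filter_linear_eq (hρ : orderOf ρ = 3) (hψ : ψ.IsPrimitive)
    (ht : t ^ 2 + t + 1 = 0) {c₁ c₂ c₃ : F} (h₁ : c₁ ≠ 0) (h₂ : c₂ ≠ 0) (h₃ : c₃ ≠ 0)
    (i j k : Fin 4) :
    (((Finset.univ.filter fun v : F × F × F => (ρ v.1 = classValue t i ∧
      ρ v.2.1 = classValue t j ∧ ρ v.2.2 = classValue t k) ∧
        v.1 * c₁ + (v.2.1 * c₂ + v.2.2 * c₃) = 0).card : ℕ) : ℂ) =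
      solutionCount (Fintype.card F) (gaussSum ρ ψ) (gaussSum ρ⁻¹ ψ) t (ρ c₁) (ρ c₂) (ρ c₃)
        i j k := by
  have hr : (Fintype.card F : ℂ) ≠ 0 := by exact_mod_cast Fintype.card_ne_zero
  rw [solutionCount, eq_div_iff hr]
  set A := Finset.univ.filter fun v : F => ρ v = classValue t i
  set B := Finset.univ.filter fun v : F => ρ v = classValue t j
  set C := Finset.univ.filter fun v : F => ρ v = classValue t k
  have hset : (Finset.univ.filter fun v : F × F × F => (ρ v.1 = classValue t i ∧
      ρ v.2.1 = classValue t j ∧ ρ v.2.2 = classValue t k) ∧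
        v.1 * c₁ + (v.2.1 * c₂ + v.2.2 * c₃) = 0) =
      (A ×ˢ (B ×ˢ C)).filter fun v => v.1 * c₁ + (v.2.1 * c₂ + v.2.2 * c₃) = 0 := by
    ext v
    simp [A, B, C]
  have hsum : ∀ u : F, ∑ v ∈ A ×ˢ (B ×ˢ C), ψ (u * (v.1 * c₁ + (v.2.1 * c₂ + v.2.2 * c₃))) =
      (∑ x ∈ A, ψ (x * (u * c₁))) * ((∑ x ∈ B, ψ (x * (u * c₂))) *
        ∑ x ∈ C, ψ (x * (u * c₃))) := by
    intro u
    rw [Finset.sum_mul_sum, ← Finset.sum_product', Finset.sum_mul_sum, ← Finset.sum_product']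
    refine Finset.sum_congr rfl fun v _ => ?_
    rw [← AddChar.map_add_eq_mul, ← AddChar.map_add_eq_mul]
    congr 1
    ring
  calc _ = ∑ v ∈ A ×ˢ (B ×ˢ C), ∑ u : F, ψ (u * (v.1 * c₁ + (v.2.1 * c₂ + v.2.2 * c₃))) := by
        rw [hset, Finset.card_filter, Nat.cast_sum, Finset.sum_mul]
        refine Finset.sum_congr rfl fun v _ => ?_
        rw [AddChar.sum_mulShift _ hψ]
        split_ifs <;> simp
    _ = ∑ u : F, (∑ x ∈ A, ψ (x * (u * c₁))) * ((∑ x ∈ B, ψ (x * (u * c₂))) *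
        ∑ x ∈ C, ψ (x * (u * c₃))) := by
        rw [Finset.sum_comm]
        exact Finset.sum_congr rfl fun u _ => hsum u
    _ = (A.card : ℂ) * (B.card * C.card) + ∑ u : F with u ≠ 0,
        (∑ x ∈ A, ψ (x * (u * c₁))) * ((∑ x ∈ B, ψ (x * (u * c₂))) *
          ∑ x ∈ C, ψ (x * (u * c₃))) := by
        rw [← Finset.sum_filter_add_sum_filter_not Finset.univ (fun u : F => u = 0)]
        congr 1
        rw [Finset.filter_eq' Finset.univ (0 : F), if_pos (Finset.mem_univ _),
          Finset.sum_singleton]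
        simp
    _ = _ := by
        rw [card_filter_classValue hρ ht, card_filter_classValue hρ ht,
          card_filter_classValue hρ ht]
        have hterm : ∀ u ∈ Finset.univ.filter (fun u : F => u ≠ 0),
            (∑ x ∈ A, ψ (x * (u * c₁))) * ((∑ x ∈ B, ψ (x * (u * c₂))) *
              ∑ x ∈ C, ψ (x * (u * c₃))) =
            (fun y => classSum (gaussSum ρ ψ) (gaussSum ρ⁻¹ ψ) t (y * ρ c₁) i *
              (classSum (gaussSum ρ ψ) (gaussSum ρ⁻¹ ψ) t (y * ρ c₂) j *
              classSum (gaussSum ρ ψ) (gaussSum ρ⁻¹ ψ) t (y * ρ c₃) k)) (ρ u) := by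
          intro u hu
          rw [Finset.mem_filter] at hu
          rw [sum_filter_classValue hρ hψ ht (mul_ne_zero hu.2 h₁),
            sum_filter_classValue hρ hψ ht (mul_ne_zero hu.2 h₂),
            sum_filter_classValue hρ hψ ht (mul_ne_zero hu.2 h₃), map_mul, map_mul, map_mul]
        have hcomp := sum_ne_zero_comp hρ ht fun y =>
          classSum (gaussSum ρ ψ) (gaussSum ρ⁻¹ ψ) t (y * ρ c₁) i *
              (classSum (gaussSum ρ ψ) (gaussSum ρ⁻¹ ψ) t (y * ρ c₂) j *
              classSum (gaussSum ρ ψ) (gaussSum ρ⁻¹ ψ) t (y * ρ c₃) k)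
        simp only [one_mul] at hcomp
        simp only [ne_eq] at hterm hcomp ⊢
        rw [Finset.sum_congr rfl hterm, hcomp]
        ring

end CubicCharacter

/-! ### The cubic character of the big field and its Gauss sum -/

section PsiRho

variable (p : ℕ) [Fact p.Prime] (F : Type*) [Field F] [Algebra (ZMod p) F]

/-- The canonical additive character `psi` of `F`, as an `AddChar`. -/
def psiChar : AddChar F ℂ :=
  (ZMod.stdAddChar (N := p)).compAddMonoidHom (Algebra.trace (ZMod p) F).toAddMonoidHom

variable {F}

lemma psiChar_apply (x : F) : psiChar p F x = ZMod.stdAddChar (Algebra.trace (ZMod p) F x) := rfl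

lemma psi_eq_psiChar (x : F) : psi p x = psiChar p F x := by
  rw [psiChar_apply, ZMod.stdAddChar_apply, ZMod.toCircle_apply, psi]
  congr 1
  ring

lemma isPrimitive_psiChar [Finite F] : (psiChar p F).IsPrimitive := by
  refine AddChar.IsPrimitive.of_ne_one fun h => ?_
  obtain ⟨x, hx⟩ := Algebra.trace_surjective (ZMod p) F 1
  have h1 : psiChar p F x = 1 := by rw [h, AddChar.one_apply]
  rw [psiChar_apply, hx, ← AddChar.map_zero_eq_one (ZMod.stdAddChar (N := p))] at h1
  exact one_ne_zero (ZMod.injective_stdAddChar h1)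

variable {p}

/-- The cubic residue character of `𝔽_p` composed with the norm; its Gauss sum is found from the
Davenport–Hasse relation and the Jacobi sum `ϖ` of the cubic residue character. -/
theorem exists_mulChar_eq_rho [Fintype F] (hp : p % 3 = 1) {ϖ : ZOmega} (hϖ : IsPrimaryOver p ϖ)
    {k : ℕ} (hF : Fintype.card F = p ^ k) (hk : 3 ∣ k) :
    ∃ ρ : MulChar F ℂ, orderOf ρ = 3 ∧ (∀ x, ρ x = rho p ϖ x) ∧
      gaussSum ρ (psiChar p F) = (-1) ^ (k + 1) * ((p : ℂ) * ϖ) ^ (k / 3) := by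
  obtain ⟨χ, hχ, hord, hJ⟩ := exists_cubicResidueChar hp hϖ
  have hkF : Module.finrank (ZMod p) F = k := by
    have h := Module.card_eq_pow_finrank (K := ZMod p) (V := F)
    rw [ZMod.card, hF] at h
    exact (Nat.pow_right_injective (Fact.out : p.Prime).two_le h).symm
  let ρ : MulChar F ℂ :=
    { toMonoidHom := χ.toMonoidHom.comp (Algebra.norm (ZMod p))
      map_nonunit' := fun x hx => by
        rw [isUnit_iff_ne_zero, not_not] at hx
        change χ (Algebra.norm (ZMod p) x) = 0
        rw [hx, Algebra.norm_zero, MulChar.map_zero] }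
  have hρ : ∀ x, ρ x = χ (Algebra.norm (ZMod p) x) := fun _ => rfl
  have hχ3 : χ ^ 3 = 1 := orderOf_dvd_iff_pow_eq_one.mp hord.dvd
  refine ⟨ρ, ?_, fun x => by rw [hρ, hχ, rho], ?_⟩
  · refine orderOf_eq_prime ?_ ?_
    · ext x
      rw [MulChar.pow_apply_coe, hρ, ← MulChar.pow_apply' χ three_ne_zero, hχ3,
        MulChar.one_apply (x.isUnit.map (Algebra.norm (ZMod p))), MulChar.one_apply_coe]
    · intro h1
      refine ne_one_of_orderOf_eq_three hord ?_
      ext a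
      obtain ⟨x, hx⟩ := FiniteField.norm_surjective (ZMod p) F a
      have hx0 : x ≠ 0 := by
        rintro rfl
        rw [Algebra.norm_zero] at hx
        exact a.ne_zero hx.symm
      rw [← hx, ← hρ, h1, MulChar.one_apply hx0.isUnit, hx, MulChar.one_apply_coe]
  · have hDH := sum_norm_trace_eq_gaussSum_pow (L := F) χ
      (ψ := ZMod.stdAddChar (N := p)) (fun h => by
        have h1 := ZMod.isPrimitive_stdAddChar p (one_ne_zero (α := ZMod p))
        rw [AddChar.mulShift_one] at h1
        exact h1 h)
    rw [hkF] at hDH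
    have h3 := gaussSum_pow_three hord (ZMod.isPrimitive_stdAddChar p)
    rw [ZMod.card, hJ] at h3
    obtain ⟨l, rfl⟩ := hk
    rw [Nat.mul_div_cancel_left _ (by norm_num), ← h3, ← pow_mul, ← hDH]
    rfl

end PsiRho

section Generator

variable {F : Type*} [Field F] {ρ : MulChar F ℂ} {α : Fˣ}

lemma sq_add_apply_generator_eq_zero (hρ : orderOf ρ = 3) (hα : ∀ x : Fˣ, x ∈ Subgroup.zpowers α) :
    ρ α ^ 2 + ρ α + 1 = 0 := by
  have h1 : (ρ α - 1) * (ρ α ^ 2 + ρ α + 1) = 0 := by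
    linear_combination apply_pow_three hρ α.ne_zero
  refine (mul_eq_zero.mp h1).resolve_left fun h => ne_one_of_orderOf_eq_three hρ ?_
  rw [MulChar.eq_iff hα, MulChar.one_apply_coe]
  exact sub_eq_zero.mp h

variable [Fintype F]

lemma generator_pow_card_sub_one : α ^ (Fintype.card F - 1) = 1 := by
  refine Units.ext ?_
  rw [Units.val_pow_eq_pow_val, FiniteField.pow_card_sub_one_eq_one _ α.ne_zero, Units.val_one]

lemma mem_zpowers_generator_pow_three_iff (hρ : orderOf ρ = 3)
    (hα : ∀ x : Fˣ, x ∈ Subgroup.zpowers α) (z : Fˣ) :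
    z ∈ Subgroup.zpowers (α ^ 3) ↔ ρ z = 1 := by
  have ht := isPrimitiveRoot_three_of_sq_add (sq_add_apply_generator_eq_zero hρ hα) (by norm_num)
  constructor
  · rw [← mem_powers_iff_mem_zpowers]
    rintro ⟨n, rfl⟩
    simp only [Units.val_pow_eq_pow_val, map_pow]
    rw [ht.pow_eq_one, one_pow]
  · obtain ⟨n, rfl⟩ := mem_powers_iff_mem_zpowers.mpr (hα z)
    simp only [Units.val_pow_eq_pow_val, map_pow]
    rw [ht.pow_eq_one_iff_dvd]
    rintro ⟨j, rfl⟩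
    rw [pow_mul]
    exact Subgroup.npow_mem_zpowers _ _

variable {p : ℕ} [Algebra (ZMod p) F]

lemma gaussPeriod_mul_of_mem {z : Fˣ} (hz : z ∈ Subgroup.zpowers (α ^ 3)) (w : F) :
    gaussPeriod p α 3 ((z : F) * w) = gaussPeriod p α 3 w := by
  classical
  rw [gaussPeriod, gaussPeriod]
  refine Finset.sum_bij (fun y _ => y * z) (fun y hy => ?_) (fun y _ y' _ h => mul_right_cancel h)
    (fun v hv => ?_) (fun y _ => ?_)
  · rw [Finset.mem_filter] at hy ⊢
    exact ⟨Finset.mem_univ _, mul_mem hy.2 hz⟩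
  · rw [Finset.mem_filter] at hv
    refine ⟨v * z⁻¹, ?_, by simp⟩
    rw [Finset.mem_filter]
    exact ⟨Finset.mem_univ _, mul_mem hv.2 (inv_mem hz)⟩
  · rw [Units.val_mul, mul_assoc]

variable [Fact p.Prime]

open Classical in
lemma gaussPeriod_eq_sum (hρ : orderOf ρ = 3) (hα : ∀ x : Fˣ, x ∈ Subgroup.zpowers α) (u : F) :
    gaussPeriod p α 3 u = ∑ v : F with ρ v = 1, psiChar p F (v * u) := by
  rw [gaussPeriod]
  refine Finset.sum_bij (fun z _ => (z : F)) (fun z hz => ?_) (fun z _ w _ h => Units.ext h)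
    (fun v hv => ?_) (fun z _ => psi_eq_psiChar p _)
  · rw [Finset.mem_filter] at hz ⊢
    exact ⟨Finset.mem_univ _, (mem_zpowers_generator_pow_three_iff hρ hα z).mp hz.2⟩
  · rw [Finset.mem_filter] at hv
    have hv0 : v ≠ 0 := by
      rintro rfl
      rw [MulChar.map_zero] at hv
      exact zero_ne_one hv.2
    refine ⟨Units.mk0 v hv0, ?_, rfl⟩
    rw [Finset.mem_filter, mem_zpowers_generator_pow_three_iff hρ hα]
    exact ⟨Finset.mem_univ _, hv.2⟩

lemma gaussPeriod_zero (hρ : orderOf ρ = 3) (hα : ∀ x : Fˣ, x ∈ Subgroup.zpowers α) :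
    gaussPeriod p α 3 (0 : F) = ((Fintype.card F : ℂ) - 1) / 3 := by
  classical
  rw [gaussPeriod_eq_sum hρ hα, ← card_filter_apply_eq hρ (one_pow 3)]
  simp

lemma gaussPeriod_eq_cubicPeriod (hρ : orderOf ρ = 3) (hα : ∀ x : Fˣ, x ∈ Subgroup.zpowers α)
    {u : F} (hu : u ≠ 0) :
    gaussPeriod p α 3 u =
      cubicPeriod (gaussSum ρ (psiChar p F)) (gaussSum ρ⁻¹ (psiChar p F)) (ρ u) := by
  rw [← mul_one (ρ u), ← sum_filter_eq_cubicPeriod hρ (isPrimitive_psiChar p) (one_pow 3) hu,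
    gaussPeriod_eq_sum hρ hα]

/-- For `u ≠ 0` the period is a nontrivial character sum, of square root size. -/
lemma norm_gaussPeriod_lt (hρ : orderOf ρ = 3) (hα : ∀ x : Fˣ, x ∈ Subgroup.zpowers α)
    (hr : 9 ≤ Fintype.card F) {u : F} (hu : u ≠ 0) :
    ‖gaussPeriod p α 3 u‖ < ((Fintype.card F : ℝ) - 1) / 3 := by
  have hG := norm_gaussSum_sq hρ (isPrimitive_psiChar p (F := F))
  have hH : ‖gaussSum ρ⁻¹ (psiChar p F)‖ = ‖gaussSum ρ (psiChar p F)‖ := by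
    rw [gaussSum_inv_eq_conj hρ, Complex.norm_conj]
  have hy : ‖ρ u‖ = 1 := by
    have := congrArg norm (apply_pow_three hρ hu)
    rw [norm_pow, norm_one] at this
    exact (pow_eq_one_iff_of_nonneg (norm_nonneg _) three_ne_zero).mp this
  rw [gaussPeriod_eq_cubicPeriod hρ hα hu, cubicPeriod, norm_div, Complex.norm_ofNat]
  have h1 : ‖ρ u ^ 2 * gaussSum ρ (psiChar p F) + ρ u * gaussSum ρ⁻¹ (psiChar p F) - 1‖ ≤
      2 * ‖gaussSum ρ (psiChar p F)‖ + 1 := by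
    refine (norm_sub_le _ _).trans ?_
    rw [norm_one]
    refine add_le_add_left ((norm_add_le _ _).trans ?_) 1
    rw [norm_mul, norm_mul, norm_pow, hy, hH]
    linarith
  have hr' : (9 : ℝ) ≤ Fintype.card F := by exact_mod_cast hr
  have h3 : 3 ≤ ‖gaussSum ρ (psiChar p F)‖ := by
    nlinarith [norm_nonneg (gaussSum ρ (psiChar p F))]
  refine div_lt_div_of_pos_right (h1.trans_lt ?_) (by norm_num)
  nlinarith

end Generator

/-! ### The Hamming weight -/

/-- The `l`-th argument of the periods in the modified weight. -/
def periodArg {F : Type*} [Field F] (α : Fˣ) (q r h : ℕ) (l : ℕ) (a b : F) : F :=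
  (a + betaElt α r 3 ^ l * b) * gElt α q h ^ l

lemma modifiedWeight_eq {p : ℕ} {F : Type*} [Field F] [Fintype F] [Algebra (ZMod p) F] {α : Fˣ}
    {q r h : ℕ} (hN : paramN q r h 3 = 3) (a b : F) :
    modifiedWeight p α q r h 3 a b = h / q * (gaussPeriod p α 3 (periodArg α q r h 1 a b) +
      gaussPeriod p α 3 (periodArg α q r h 2 a b) +
      gaussPeriod p α 3 (periodArg α q r h 3 a b)) := by
  have hI : Finset.Icc 1 3 = {1, 2, 3} := by decide
  rw [modifiedWeight, hN, hI, Finset.sum_insert (by decide), Finset.sum_insert (by decide),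
    Finset.sum_singleton]
  simp only [periodArg]
  push_cast
  field_simp
  ring

section Weight

variable {p : ℕ} [Fact p.Prime] {K F : Type*} [Field K] [Field F] [Fintype K] [Fintype F]
  [Algebra (ZMod p) F] [Algebra K F]

/-- Orthogonality: the additive characters of `F` restricted to the line `K w` detect whether the
relative trace of `w` vanishes. -/
lemma sum_psiChar_algebraMap_mul [DecidableEq K] (w : F) :
    ∑ y : K, psiChar p F (algebraMap K F y * w) =
      if Algebra.trace K F w = 0 then (Fintype.card K : ℂ) else 0 := by
  have hcK : CharP K p := by
    have : CharP F p := charP_of_injective_algebraMap (algebraMap (ZMod p) F).injective p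
    exact (algebraMap K F).charP (algebraMap K F).injective p
  let _ : Algebra (ZMod p) K := ZMod.algebra K p
  have : IsScalarTower (ZMod p) K F := IsScalarTower.of_algebraMap_eq fun x =>
    congrArg (fun f : ZMod p →+* F => f x) (RingHom.ext_zmod _ ((algebraMap K F).comp _))
  have h : ∀ y : K, psiChar p F (algebraMap K F y * w) =
      psiChar p K (y * Algebra.trace K F w) := fun y => by
    rw [psiChar_apply, psiChar_apply, ← Algebra.smul_def,
      ← Algebra.trace_trace (S := K), map_smul, smul_eq_mul]
  rw [Finset.sum_congr rfl fun y _ => h y, AddChar.sum_mulShift _ (isPrimitive_psiChar p)]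
  split_ifs <;> simp

variable {α : Fˣ} {h A B : ℕ}

/-- The double sum over `K` and the powers of `g ^ 3`, where `g = α ^ B`, depends only on the coset
of `w` modulo the cubes: it is invariant under `Kˣ ∋ α ^ (3 A)` and under `g ^ 3 = α ^ (3 B)`, and
these generate the cubes. -/
lemma sum_sum_psiChar_mul_of_mem (hK : Fintype.card K - 1 = h * B)
    (hF : Fintype.card F - 1 = 3 * A * (h * B)) (hgcd : Nat.gcd (3 * A) (3 * B) = 3)
    {z : Fˣ} (hz : z ∈ Subgroup.zpowers (α ^ 3)) (w : F) :
    ∑ y : K, ∑ k ∈ Finset.range (h * A),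
        psiChar p F (algebraMap K F y * ((α : F) ^ (3 * B * k) * (w * z))) =
      ∑ y : K, ∑ k ∈ Finset.range (h * A),
        psiChar p F (algebraMap K F y * ((α : F) ^ (3 * B * k) * w)) := by
  set S : F → ℂ := fun w => ∑ y : K, ∑ k ∈ Finset.range (h * A),
    psiChar p F (algebraMap K F y * ((α : F) ^ (3 * B * k) * w)) with hS
  let T : Subgroup Fˣ :=
    { carrier := {c | ∀ w, S (w * c) = S w}
      mul_mem' := fun {a b} ha hb w => by
        rw [Units.val_mul, ← mul_assoc, hb, ha]
      one_mem' := fun w => by rw [Units.val_one, mul_one]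
      inv_mem' := fun {a} ha w => by
        have := ha (w * (a⁻¹ : Fˣ))
        rwa [mul_assoc, Units.inv_mul, mul_one, eq_comm] at this }
  have hhB : 0 < h * B := by rw [← hK]; have := Fintype.one_lt_card (α := K); omega
  have h1 : α ^ (3 * A) ∈ T := by
    intro w
    have hn := FiniteField.algebraMap_norm_eq_pow (K := K) (x := (α : F))
    rw [Nat.card_eq_fintype_card, Nat.card_eq_fintype_card, hF, hK,
      Nat.mul_div_cancel _ hhB] at hn
    have hy0 : Algebra.norm K (α : F) ≠ 0 := by
      intro h0
      rw [h0, map_zero] at hn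
      exact pow_ne_zero _ α.ne_zero hn.symm
    rw [hS]
    simp only
    rw [← Equiv.sum_comp (Equiv.mulRight₀ _ hy0) fun y : K => ∑ k ∈ Finset.range (h * A),
      psiChar p F (algebraMap K F y * ((α : F) ^ (3 * B * k) * w))]
    refine Finset.sum_congr rfl fun y _ => Finset.sum_congr rfl fun k _ => ?_
    change _ = psiChar p F (algebraMap K F (y * Algebra.norm K (α : F)) * _)
    rw [map_mul (algebraMap K F), hn, Units.val_pow_eq_pow_val]
    congr 1
    ring
  have h2 : α ^ (3 * B) ∈ T := by
    intro w
    rw [hS]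
    simp only
    refine Finset.sum_congr rfl fun y _ => ?_
    have hstep : ∀ k, psiChar p F (algebraMap K F y *
        ((α : F) ^ (3 * B * k) * (w * ((α ^ (3 * B) : Fˣ) : F)))) =
        psiChar p F (algebraMap K F y * ((α : F) ^ (3 * B * (k + 1)) * w)) := fun k => by
      rw [Units.val_pow_eq_pow_val]
      congr 1
      ring
    have hlast : (α : F) ^ (3 * B * (h * A)) = 1 := by
      rw [show 3 * B * (h * A) = Fintype.card F - 1 by rw [hF]; ring, ← Units.val_pow_eq_pow_val,
        generator_pow_card_sub_one, Units.val_one]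
    rw [Finset.sum_congr rfl fun k _ => hstep k]
    have h3 := Finset.sum_range_succ (fun k =>
      psiChar p F (algebraMap K F y * ((α : F) ^ (3 * B * k) * w))) (h * A)
    rw [Finset.sum_range_succ', hlast, mul_zero, pow_zero] at h3
    exact add_right_cancel h3
  have h3 : α ^ 3 ∈ T := by
    have hb := Nat.gcd_eq_gcd_ab (3 * A) (3 * B)
    rw [hgcd] at hb
    have : α ^ 3 = (α ^ (3 * A)) ^ (Nat.gcdA (3 * A) (3 * B)) *
        (α ^ (3 * B)) ^ (Nat.gcdB (3 * A) (3 * B)) := by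
      rw [← zpow_natCast α (3 * A), ← zpow_natCast α (3 * B), ← zpow_mul, ← zpow_mul, ← zpow_add,
        ← hb]
      rfl
    rw [this]
    exact mul_mem (zpow_mem h1 _) (zpow_mem h2 _)
  exact (Subgroup.zpowers_le.mpr h3 hz) w

lemma algebraMap_mem_zpowers (hα : ∀ x : Fˣ, x ∈ Subgroup.zpowers α)
    (hK : Fintype.card K - 1 = h * B) (hF : Fintype.card F - 1 = 3 * A * (h * B)) (y : Kˣ) :
    Units.map (algebraMap K F).toMonoidHom y ∈ Subgroup.zpowers (α ^ 3) := by
  obtain ⟨n, hn⟩ := mem_powers_iff_mem_zpowers.mpr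
    (hα (Units.map (algebraMap K F).toMonoidHom y))
  change α ^ n = _ at hn
  have hhB : 0 < h * B := by rw [← hK]; have := Fintype.one_lt_card (α := K); omega
  have h1 : α ^ (n * (h * B)) = 1 := by
    rw [pow_mul, hn, ← map_pow, ← hK, generator_pow_card_sub_one, map_one]
  have hord : orderOf α = Fintype.card F - 1 := by
    classical
    rw [orderOf_eq_card_of_forall_mem_zpowers hα, Nat.card_eq_fintype_card, Fintype.card_units]
  have h2 := orderOf_dvd_of_pow_eq_one h1
  rw [hord, hF] at h2
  obtain ⟨j, rfl⟩ := (Nat.dvd_of_mul_dvd_mul_right hhB h2 : 3 * A ∣ n)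
  rw [← hn, mul_assoc, pow_mul]
  exact Subgroup.npow_mem_zpowers _ _

/-- The double sum over `K` and the powers of `g ^ 3` covers each cube `h` times. -/
lemma sum_sum_psiChar_eq {ρ : MulChar F ℂ} (hρ : orderOf ρ = 3)
    (hα : ∀ x : Fˣ, x ∈ Subgroup.zpowers α)
    (hK : Fintype.card K - 1 = h * B) (hF : Fintype.card F - 1 = 3 * A * (h * B))
    (hgcd : Nat.gcd (3 * A) (3 * B) = 3) (w : F) :
    ∑ y : K, ∑ k ∈ Finset.range (h * A),
        psiChar p F (algebraMap K F y * ((α : F) ^ (3 * B * k) * w)) =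
      h * A + h * gaussPeriod p α 3 w := by
  classical
  set C : Finset Fˣ := Finset.univ.filter fun z => z ∈ Subgroup.zpowers (α ^ 3) with hC
  have hr1 : 0 < 3 * A * (h * B) := by
    rw [← hF]; have := Fintype.one_lt_card (α := F); omega
  have hcardK : (Fintype.card K : ℂ) = h * B + 1 := by
    have : Fintype.card K = h * B + 1 := by have := Fintype.one_lt_card (α := K); omega
    exact_mod_cast this
  have hcardF : (Fintype.card F : ℂ) = 3 * A * (h * B) + 1 := by
    have : Fintype.card F = 3 * A * (h * B) + 1 := by
      have := Fintype.one_lt_card (α := F); omega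
    exact_mod_cast this
  have hCcard : (C.card : ℂ) = A * (h * B) := by
    have h1 := gaussPeriod_zero (p := p) hρ hα
    rw [gaussPeriod] at h1
    simp only [mul_zero, psi_eq_psiChar, AddChar.map_zero_eq_one, Finset.sum_const,
      nsmul_eq_mul, mul_one] at h1
    rw [hC, h1, hcardF]
    ring
  have hAhB : (A : ℂ) * (h * B) ≠ 0 := by
    have : 3 * (A * (h * B)) ≠ 0 := by rw [← mul_assoc]; exact hr1.ne'
    exact_mod_cast right_ne_zero_of_mul this
  have hzero : ∀ y : K, ∀ k, ∑ z ∈ C, psiChar p F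
      (algebraMap K F y * ((α : F) ^ (3 * B * k) * (w * z))) =
      gaussPeriod p α 3 w + if y = 0 then (C.card : ℂ) - gaussPeriod p α 3 w else 0 := by
    intro y k
    rcases eq_or_ne y 0 with rfl | hy
    · simp
    · have hmem : Units.map (algebraMap K F).toMonoidHom (Units.mk0 y hy) * (α ^ 3) ^ (B * k) ∈
          Subgroup.zpowers (α ^ 3) :=
        mul_mem (algebraMap_mem_zpowers hα hK hF _) (Subgroup.npow_mem_zpowers _ _)
      rw [if_neg hy, add_zero, ← gaussPeriod_mul_of_mem hmem, gaussPeriod]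
      refine Finset.sum_congr rfl fun z _ => ?_
      rw [psi_eq_psiChar, Units.val_mul, Units.val_pow_eq_pow_val, Units.val_pow_eq_pow_val,
        ← pow_mul]
      congr 1
      change algebraMap K F y * _ = (z : F) * (algebraMap K F y * _ * w)
      ring
  refine mul_left_cancel₀ hAhB ?_
  calc _ = ∑ z ∈ C, ∑ y : K, ∑ k ∈ Finset.range (h * A),
        psiChar p F (algebraMap K F y * ((α : F) ^ (3 * B * k) * (w * z))) := by
        rw [Finset.sum_congr rfl fun z hz =>
          sum_sum_psiChar_mul_of_mem hK hF hgcd (Finset.mem_filter.mp hz).2 w,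
          Finset.sum_const, nsmul_eq_mul, hCcard]
    _ = ∑ y : K, ∑ k ∈ Finset.range (h * A), (gaussPeriod p α 3 w +
        if y = 0 then (C.card : ℂ) - gaussPeriod p α 3 w else 0) := by
        rw [Finset.sum_comm]
        refine Finset.sum_congr rfl fun y _ => ?_
        rw [Finset.sum_comm]
        exact Finset.sum_congr rfl fun k _ => hzero y k
    _ = _ := by
        simp only [Finset.sum_const, Finset.card_range, nsmul_eq_mul, ← Finset.mul_sum,
          Finset.sum_add_distrib, Finset.card_univ, Finset.sum_ite_eq', Finset.mem_univ, if_true,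
          hCcard, hcardK]
        push_cast
        ring

lemma sum_range_three_mul {M : Type*} [AddCommMonoid M] (f : ℕ → M) (n : ℕ) :
    ∑ i ∈ Finset.range (3 * n), f i =
      ∑ k ∈ Finset.range n, (f (3 * k) + f (3 * k + 1) + f (3 * k + 2)) := by
  induction n with
  | zero => simp
  | succ n ih =>
    rw [Finset.sum_range_succ, ← ih, mul_add, mul_one, Finset.sum_range_succ,
      Finset.sum_range_succ, Finset.sum_range_succ]
    simp only [add_assoc]

/-- The Hamming weight, in terms of Gaussian periods. -/
theorem hammingNorm_codeword_eq [DecidableEq K] {ρ : MulChar F ℂ} (hρ : orderOf ρ = 3)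
    (hα : ∀ x : Fˣ, x ∈ Subgroup.zpowers α) {q r : ℕ} (hq : Fintype.card K = q)
    (hr : Fintype.card F = r) (hK : q - 1 = h * B) (hF : r - 1 = 3 * A * (h * B))
    (hgcd : Nat.gcd (3 * A) (3 * B) = 3) (hN : paramN q r h 3 = 3) (a b : F) :
    (hammingNorm (codeword K α q r h 3 a b) : ℂ) =
      h * (r - 1) / q - modifiedWeight p α q r h 3 a b := by
  have hq1 : 1 < q := hq ▸ Fintype.one_lt_card
  have hr1 : 1 < r := hr ▸ Fintype.one_lt_card
  have hhB : 0 < h * B := by omega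
  have hh : 0 < h := Nat.pos_of_mul_pos_right hhB
  have hq0 : (q : ℂ) ≠ 0 := by exact_mod_cast (by omega : q ≠ 0)
  have hqC : (q : ℂ) = h * B + 1 := by exact_mod_cast (by omega : q = h * B + 1)
  have hrC : (r : ℂ) = 3 * A * (h * B) + 1 := by
    exact_mod_cast (by omega : r = 3 * A * (h * B) + 1)
  have hlen : codeLength q r h = 3 * (h * A) := by
    rw [codeLength, hF, hK, Nat.mul_div_cancel _ hhB]
    ring
  have hg : gElt α q h = (α : F) ^ B := by
    rw [gElt, hK, Nat.mul_div_cancel_left _ hh]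
  set β : F := betaElt α r 3 with hβ
  have hβ3 : β ^ 3 = 1 := by
    rw [hβ, betaElt, ← pow_mul, Nat.div_mul_cancel ⟨A * (h * B), by rw [hF]; ring⟩, ← hr,
      ← Units.val_pow_eq_pow_val, generator_pow_card_sub_one, Units.val_one]
  let x : ℕ → F := fun i => a * (α : F) ^ (B * i) + b * (β ^ i * (α : F) ^ (B * i))
  have hcw : ∀ i, codeword K α q r h 3 a b i = Algebra.trace K F (x i) := fun i => by
    rw [codeword, hg, ← hβ, mul_pow, ← pow_mul]
  have hx : ∀ k, x (3 * k) = (α : F) ^ (3 * B * k) * (a + b) ∧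
      x (3 * k + 1) = (α : F) ^ (3 * B * k) * ((a + β * b) * (α : F) ^ B) ∧
      x (3 * k + 2) = (α : F) ^ (3 * B * k) * ((a + β ^ 2 * b) * ((α : F) ^ B) ^ 2) := by
    intro k
    have h0 : β ^ (3 * k) = 1 := by rw [pow_mul, hβ3, one_pow]
    refine ⟨?_, ?_, ?_⟩
    · simp only [x, h0]; ring
    · simp only [x, pow_add, h0]; ring
    · simp only [x, pow_add, h0]; ring
  have hsum : ∑ y : K, ∑ i ∈ Finset.range (3 * (h * A)), psiChar p F (algebraMap K F y * x i) =
      3 * (h * A) + h * (gaussPeriod p α 3 (a + b) +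
        gaussPeriod p α 3 ((a + β * b) * (α : F) ^ B) +
        gaussPeriod p α 3 ((a + β ^ 2 * b) * ((α : F) ^ B) ^ 2)) := by
    simp only [sum_range_three_mul, (hx _).1, (hx _).2.1, (hx _).2.2, Finset.sum_add_distrib]
    rw [sum_sum_psiChar_eq hρ hα (by rw [hq, hK]) (by rw [hr, hF]) hgcd,
      sum_sum_psiChar_eq hρ hα (by rw [hq, hK]) (by rw [hr, hF]) hgcd,
      sum_sum_psiChar_eq hρ hα (by rw [hq, hK]) (by rw [hr, hF]) hgcd]
    ring
  have hnorm : (q : ℂ) * hammingNorm (codeword K α q r h 3 a b) = q * (3 * (h * A)) -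
      ∑ y : K, ∑ i ∈ Finset.range (3 * (h * A)), psiChar p F (algebraMap K F y * x i) := by
    rw [Finset.sum_comm]
    simp only [sum_psiChar_algebraMap_mul, hq]
    rw [← hlen, Finset.sum_range, hammingNorm, Finset.card_filter, Nat.cast_sum, Finset.mul_sum,
      eq_sub_iff_add_eq, ← Finset.sum_add_distrib]
    have hone : ∀ i : Fin (codeLength q r h), ((q : ℂ) *
        ((if codeword K α q r h 3 a b i ≠ 0 then 1 else 0 : ℕ) : ℂ) +
        if Algebra.trace K F (x i) = 0 then (q : ℂ) else 0) = q := fun i => by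
      rw [hcw]
      by_cases h0 : Algebra.trace K F (x i) = 0 <;> simp [h0]
    rw [Finset.sum_congr rfl fun i _ => hone i, Finset.sum_const, Finset.card_univ,
      Fintype.card_fin, nsmul_eq_mul, hlen]
    push_cast
    ring
  have hperiod : gaussPeriod p α 3 ((a + β ^ 3 * b) * ((α : F) ^ B) ^ 3) =
      gaussPeriod p α 3 (a + b) := by
    have hmem : (α ^ 3) ^ B ∈ Subgroup.zpowers (α ^ 3) := Subgroup.npow_mem_zpowers _ _
    rw [← gaussPeriod_mul_of_mem hmem (a + b), hβ3]
    congr 1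
    rw [Units.val_pow_eq_pow_val, Units.val_pow_eq_pow_val]
    ring
  have hmw : modifiedWeight p α q r h 3 a b = h / q * (gaussPeriod p α 3 (a + b) +
      gaussPeriod p α 3 ((a + β * b) * (α : F) ^ B) +
      gaussPeriod p α 3 ((a + β ^ 2 * b) * ((α : F) ^ B) ^ 2)) := by
    rw [modifiedWeight_eq hN, periodArg, periodArg, periodArg, hg, ← hβ, hperiod, pow_one, pow_one]
    ring
  refine mul_left_cancel₀ hq0 ?_
  rw [hnorm, hsum, hmw, mul_sub, mul_div_cancel₀ _ hq0, ← mul_assoc, ← mul_assoc (q : ℂ) (h / q),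
    mul_div_cancel₀ _ hq0, hqC, hrC]
  ring

end Weight

/-! ### Closed form of the solution counts -/

/-- The number of solutions with all variables nonzero; `u₁`, `u₂`, `u₃` are the values of the
cubic character at the three summands, and `-U`, `-V` are the Jacobi sums of the character and its
inverse. -/
def tripleCount (r U V u₁ u₂ u₃ : ℂ) : ℂ :=
  (r - 1) / 27 * (r - 2 - (u₁ ^ 2 * u₂ + u₁ ^ 2 * u₃ + u₂ ^ 2 * u₁ + u₂ ^ 2 * u₃ + u₃ ^ 2 * u₁ +
    u₃ ^ 2 * u₂) - ((u₁ * u₂ * u₃) ^ 2 * U + u₁ * u₂ * u₃ * V))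

/-- The number of solutions with exactly one variable zero. -/
def pairCount (r u₁ u₂ : ℂ) : ℂ := (r - 1) / 9 * (1 + u₁ ^ 2 * u₂ + u₂ ^ 2 * u₁)

/-- The closed form of `solutionCount`. -/
def closedCount (r U V t y₁ y₂ y₃ : ℂ) (i j k : Fin 4) : ℂ :=
  if i = 3 then
    if j = 3 then if k = 3 then 1 else 0
    else if k = 3 then 0 else pairCount r (y₂ * classValue t j) (y₃ * classValue t k)
  else if j = 3 then
    if k = 3 then 0 else pairCount r (y₁ * classValue t i) (y₃ * classValue t k)
  else if k = 3 then pairCount r (y₁ * classValue t i) (y₂ * classValue t j)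
  else tripleCount r U V (y₁ * classValue t i) (y₂ * classValue t j) (y₃ * classValue t k)

section ClosedForm

variable {r G H U V t : ℂ}

lemma sum_cubicPeriod (ht : t ^ 2 + t + 1 = 0) (u : ℂ) :
    cubicPeriod G H u + cubicPeriod G H (t * u) + cubicPeriod G H (t ^ 2 * u) = -1 := by
  simp only [cubicPeriod]
  linear_combination (u ^ 2 * G * (t ^ 2 - t + 1) + u * H) / 3 * ht

lemma sum_cubicPeriod_mul (ht : t ^ 2 + t + 1 = 0) (hGH : G * H = r) (u₁ u₂ : ℂ) :
    cubicPeriod G H u₁ * cubicPeriod G H u₂ +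
      cubicPeriod G H (t * u₁) * cubicPeriod G H (t * u₂) +
      cubicPeriod G H (t ^ 2 * u₁) * cubicPeriod G H (t ^ 2 * u₂) =
      (1 + r * (u₁ ^ 2 * u₂ + u₂ ^ 2 * u₁)) / 3 := by
  simp only [cubicPeriod]
  grind

/-- The triple products, summed over the translates by the cubes. -/
lemma sum_cubicPeriod_mul_mul (ht : t ^ 2 + t + 1 = 0) (hGH : G * H = r) (hG : G ^ 3 = -(r * U))
    (hH : H ^ 3 = -(r * V)) (u₁ u₂ u₃ : ℂ) :
    cubicPeriod G H u₁ * cubicPeriod G H u₂ * cubicPeriod G H u₃ +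
      cubicPeriod G H (t * u₁) * cubicPeriod G H (t * u₂) * cubicPeriod G H (t * u₃) +
      cubicPeriod G H (t ^ 2 * u₁) * cubicPeriod G H (t ^ 2 * u₂) * cubicPeriod G H (t ^ 2 * u₃) =
      (-1 - r * ((u₁ * u₂ * u₃) ^ 2 * U + u₁ * u₂ * u₃ * V) -
        r * (u₁ ^ 2 * u₂ + u₁ ^ 2 * u₃ + u₂ ^ 2 * u₁ + u₂ ^ 2 * u₃ + u₃ ^ 2 * u₁ +
          u₃ ^ 2 * u₂)) / 9 := by
  simp only [cubicPeriod]
  grind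

lemma classSum_three (y : ℂ) : classSum G H t y 3 = 1 := rfl

lemma classSum_of_ne {i : Fin 4} (hi : i ≠ 3) (y : ℂ) :
    classSum G H t y i = cubicPeriod G H (y * classValue t i) := by
  fin_cases i
  · exact congrArg (cubicPeriod G H) (mul_one y).symm
  · rfl
  · rfl
  · exact absurd rfl hi

lemma classSize_of_ne {i : Fin 4} (hi : i ≠ 3) : classSize r i = (r - 1) / 3 := by
  fin_cases i
  · rfl
  · rfl
  · rfl
  · exact absurd rfl hi

lemma classSize_three : classSize r 3 = 1 := rfl

lemma solutionCount_eq_closedCount (ht : t ^ 2 + t + 1 = 0) (hr : r ≠ 0) (hGH : G * H = r)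
    (hG : G ^ 3 = -(r * U)) (hH : H ^ 3 = -(r * V)) (y₁ y₂ y₃ : ℂ) (i j k : Fin 4) :
    solutionCount r G H t y₁ y₂ y₃ i j k = closedCount r U V t y₁ y₂ y₃ i j k := by
  rw [solutionCount, closedCount, div_eq_iff hr]
  split_ifs with hi hj hk hk hj hk hk
  · subst hi hj hk
    simp only [classSum_three, classSize_three]
    ring
  · subst hi hj
    simp only [classSum_three, classSize_three, classSum_of_ne hk, classSize_of_ne hk]
    have h := sum_cubicPeriod (G := G) (H := H) ht (y₃ * classValue t k)
    simp only [mul_assoc] at h ⊢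
    linear_combination (r - 1) / 3 * h
  · subst hi hk
    simp only [classSum_three, classSize_three, classSum_of_ne hj, classSize_of_ne hj]
    have h := sum_cubicPeriod (G := G) (H := H) ht (y₂ * classValue t j)
    simp only [mul_assoc] at h ⊢
    linear_combination (r - 1) / 3 * h
  · subst hi
    simp only [classSum_three, classSize_three, classSum_of_ne hj, classSize_of_ne hj,
      classSum_of_ne hk, classSize_of_ne hk]
    have h := sum_cubicPeriod_mul ht hGH (y₂ * classValue t j) (y₃ * classValue t k)
    simp only [mul_assoc, pairCount] at h ⊢
    linear_combination (r - 1) / 3 * h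
  · subst hj hk
    simp only [classSum_three, classSize_three, classSum_of_ne hi, classSize_of_ne hi]
    have h := sum_cubicPeriod (G := G) (H := H) ht (y₁ * classValue t i)
    simp only [mul_assoc] at h ⊢
    linear_combination (r - 1) / 3 * h
  · subst hj
    simp only [classSum_three, classSize_three, classSum_of_ne hi, classSize_of_ne hi,
      classSum_of_ne hk, classSize_of_ne hk]
    have h := sum_cubicPeriod_mul ht hGH (y₁ * classValue t i) (y₃ * classValue t k)
    simp only [mul_assoc, pairCount] at h ⊢
    linear_combination (r - 1) / 3 * h
  · subst hk
    simp only [classSum_three, classSize_three, classSum_of_ne hi, classSize_of_ne hi,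
      classSum_of_ne hj, classSize_of_ne hj]
    have h := sum_cubicPeriod_mul ht hGH (y₁ * classValue t i) (y₂ * classValue t j)
    simp only [mul_assoc, pairCount] at h ⊢
    linear_combination (r - 1) / 3 * h
  · simp only [classSum_of_ne hi, classSize_of_ne hi, classSum_of_ne hj, classSize_of_ne hj,
      classSum_of_ne hk, classSize_of_ne hk]
    have h := sum_cubicPeriod_mul_mul ht hGH hG hH (y₁ * classValue t i) (y₂ * classValue t j)
      (y₃ * classValue t k)
    rw [tripleCount]
    simp only [mul_assoc t, mul_assoc (t ^ 2)] at h ⊢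
    linear_combination (r - 1) / 3 * h

end ClosedForm

/-! ### The rows of the weight table -/

/-- The row of the weight table that belongs to the classes `i`, `j`, `k` of the three arguments of
the periods; it depends only on the multiset `{i, j, k}`. Here `P` gives the row for the case in
which one of the arguments is zero. -/
def tripleRow (P : Fin 4 → Fin 4 → Fin 14) : Fin 4 → Fin 4 → Fin 4 → Fin 14 :=
  ![![![0, 3, 4, P 0 0], ![3, 5, 9, P 0 1], ![4, 9, 7, P 0 2], P 0],
    ![![3, 5, 9, P 1 0], ![5, 1, 6, P 1 1], ![9, 6, 8, P 1 2], P 1],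
    ![![4, 9, 7, P 2 0], ![9, 6, 8, P 2 1], ![7, 8, 2, P 2 2], P 2],
    P]

/-- The row for the classes of two arguments when the third is zero and `g` is a cube. The pairs
of distinct classes of nonzero elements do not occur; they are put into the last row. -/
def pairRowA : Fin 4 → Fin 4 → Fin 14 :=
  ![![10, 13, 13, 13], ![13, 11, 13, 13], ![13, 13, 12, 13], ![13, 13, 13, 13]]

/-- The row for the classes of two arguments when the third is zero and `g` is not a cube. The
pairs of equal classes of nonzero elements do not occur; they are put into the last row. -/
def pairRowB : Fin 4 → Fin 4 → Fin 14 :=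
  ![![13, 10, 11, 13], ![10, 13, 12, 13], ![11, 12, 13, 13], ![13, 13, 13, 13]]

lemma sum_tripleRow_eq (P : Fin 4 → Fin 4 → Fin 14) (M : Fin 4 → Fin 4 → Fin 4 → ℂ) (i : Fin 14) :
    ∑ τ : Fin 4 × Fin 4 × Fin 4 with tripleRow P τ.1 τ.2.1 τ.2.2 = i, M τ.1 τ.2.1 τ.2.2 =
      ∑ a, ∑ b, ∑ c, if tripleRow P a b c = i then M a b c else 0 := by
  rw [Finset.sum_filter, Fintype.sum_prod_type]
  simp only [Fintype.sum_prod_type]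

set_option maxHeartbeats 4000000 in
/-- The frequencies when `g` is a cube: all three coefficients of the linear equation are cubes. -/
lemma sum_closedCount_eq_freqsA {r U V t : ℂ} (ht : t ^ 2 + t + 1 = 0) {k : ℕ} {ϖ : ℂ}
    (hU : U = (-1) ^ k * ϖ ^ k) (hV : V = (-1) ^ k * conj ϖ ^ k) (i : Fin 14) :
    ∑ τ : Fin 4 × Fin 4 × Fin 4 with tripleRow pairRowA τ.1 τ.2.1 τ.2.2 = i,
      closedCount r U V t 1 1 1 τ.1 τ.2.1 τ.2.2 = freqsA r k ϖ t i := by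
  rw [sum_tripleRow_eq]
  fin_cases i <;>
  simp [Fin.sum_univ_four, tripleRow, pairRowA, closedCount, classValue,
    tripleCount, pairCount, freqsA] <;> grind

set_option maxHeartbeats 4000000 in
/-- The frequencies when `g` is not a cube; here `y` is the value of the cubic character at `g`. -/
lemma sum_closedCount_eq_freqsB {r U V t y : ℂ} (ht : t ^ 2 + t + 1 = 0) (hy : y = t ∨ y = t ^ 2)
    {k : ℕ} {ϖ : ℂ} (hU : U = (-1) ^ k * ϖ ^ k) (hV : V = (-1) ^ k * conj ϖ ^ k) (i : Fin 14) :
    ∑ τ : Fin 4 × Fin 4 × Fin 4 with tripleRow pairRowB τ.1 τ.2.1 τ.2.2 = i,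
      closedCount r U V t (y ^ 2) y 1 τ.1 τ.2.1 τ.2.2 = freqsB r k ϖ t i := by
  rw [sum_tripleRow_eq]
  rcases hy with rfl | rfl <;> fin_cases i <;>
  simp [Fin.sum_univ_four, tripleRow, pairRowB, closedCount, classValue,
    tripleCount, pairCount, freqsB] <;> grind

/-- The modified weight of a pair whose three arguments of the periods lie in given classes. -/
def classWeight (h q r x y z : ℂ) (i j k : Fin 4) : ℂ :=
  h / q * ((![x, y, z, (r - 1) / 3] : Fin 4 → ℂ) i + (![x, y, z, (r - 1) / 3] : Fin 4 → ℂ) j +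
    (![x, y, z, (r - 1) / 3] : Fin 4 → ℂ) k)

set_option maxHeartbeats 4000000 in
/-- Classes that occur have the weight of their row; the relation `x + y + z = -1` gives the
row `-(h / q)`, in which the three classes are distinct. -/
lemma closedCount_eq_zero_or_weightsA {h q r U V t x y z : ℂ} (ht : t ^ 2 + t + 1 = 0)
    (hxyz : x + y + z = -1) (i j k : Fin 4) :
    closedCount r U V t 1 1 1 i j k = 0 ∨
      classWeight h q r x y z i j k = weightsA h q r x y z (tripleRow pairRowA i j k) := by
  fin_cases i <;> fin_cases j <;> fin_cases k <;>
  first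
  | (right
     simp only [classWeight, weightsA, tripleRow, pairRowA, Fin.zero_eta, Fin.mk_one,
       Fin.reduceFinMk, Matrix.cons_val]
     first | done | ring1 | linear_combination (h / q) * hxyz)
  | (left; simp [closedCount, classValue, pairCount]; first | done | grind)

set_option maxHeartbeats 4000000 in
lemma closedCount_eq_zero_or_weightsB {h q r U V t x y z u : ℂ} (ht : t ^ 2 + t + 1 = 0)
    (hu : u = t ∨ u = t ^ 2) (hxyz : x + y + z = -1) (i j k : Fin 4) :
    closedCount r U V t (u ^ 2) u 1 i j k = 0 ∨
      classWeight h q r x y z i j k = weightsB h q r x y z (tripleRow pairRowB i j k) := by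
  fin_cases i <;> fin_cases j <;> fin_cases k <;>
  first
  | (right
     simp only [classWeight, weightsB, tripleRow, pairRowB, Fin.zero_eta, Fin.mk_one,
       Fin.reduceFinMk, Matrix.cons_val]
     first | done | ring1 | linear_combination (h / q) * hxyz)
  | (left; rcases hu with rfl | rfl <;> simp [closedCount, classValue, pairCount] <;> grind)

/-! ### The weight distribution -/

/-- A distribution read off from a finer classification `cls`: every nonempty class `τ` has its
value `W τ` in the row `row τ`, and the sizes `M τ` of the classes add up to the frequencies. -/
lemma isDistributedAs_of_fiber_card {X T ι : Type*} [Fintype X] [Fintype T] [DecidableEq T]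
    [Fintype ι] [DecidableEq ι] {val : X → ℂ} {weight freq : ι → ℂ} (cls : X → T) (row : T → ι)
    {W M : T → ℂ} (hval : ∀ x, val x = W (cls x))
    (hM : ∀ τ, ((Finset.univ.filter fun x => cls x = τ).card : ℂ) = M τ)
    (hW : ∀ τ, M τ = 0 ∨ W τ = weight (row τ))
    (hfreq : ∀ i, ∑ τ with row τ = i, M τ = freq i) :
    IsDistributedAs val weight freq := by
  classical
  have hrow : ∀ x, val x = weight (row (cls x)) := fun x => by
    rw [hval]
    refine (hW (cls x)).resolve_left fun h0 => ?_
    rw [← hM, Nat.cast_eq_zero, Finset.card_eq_zero] at h0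
    have : x ∈ Finset.univ.filter fun y => cls y = cls x := by simp
    rw [h0] at this
    exact absurd this (Finset.notMem_empty x)
  refine ⟨fun i => (Finset.univ.filter fun x => row (cls x) = i).card, fun i => ?_, fun w => ?_⟩
  · beta_reduce
    rw [← hfreq, Finset.card_eq_sum_card_fiberwise (f := cls)
      (s := Finset.univ.filter fun x => row (cls x) = i)
      (t := Finset.univ.filter fun τ => row τ = i) (fun x hx => by simpa using hx), Nat.cast_sum]
    refine Finset.sum_congr rfl fun τ hτ => ?_
    rw [← hM, Finset.filter_filter]
    congr 2
    ext x
    simp only [Finset.mem_filter, Finset.mem_univ, true_and] at hτ ⊢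
    exact ⟨fun h => h.2, fun h => ⟨by rw [h, hτ], h⟩⟩
  · rw [Nat.card_eq_fintype_card, Fintype.card_subtype,
      Finset.card_eq_sum_card_fiberwise (f := fun x => row (cls x))
      (s := Finset.univ.filter fun x => val x = w) (t := Finset.univ.filter fun i => weight i = w)
      (fun x hx => by
        simp only [Finset.coe_filter, Finset.mem_univ, true_and, Set.mem_ofPred_eq] at hx ⊢
        rw [← hrow, hx])]
    refine Finset.sum_congr (by congr) fun i hi => ?_
    rw [Finset.filter_filter]
    congr 1
    ext x
    simp only [Finset.mem_filter, Finset.mem_univ, true_and] at hi ⊢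
    exact ⟨fun h => h.2, fun h => ⟨by rw [hrow, h, hi], h⟩⟩

lemma IsDistributedAs.of_equiv {X Y ι : Type*} [Fintype ι] {val : X → ℂ} {val' : Y → ℂ}
    {weight freq : ι → ℂ} (h : IsDistributedAs val weight freq) (e : X ≃ Y)
    (he : ∀ x, val' (e x) = val x) : IsDistributedAs val' weight freq := by
  obtain ⟨f, hf, hcard⟩ := h
  refine ⟨f, hf, fun w => ?_⟩
  rw [← hcard w]
  exact Nat.card_congr (e.subtypeEquiv fun x => by rw [he]).symm

section Distribution

variable {p : ℕ} {F : Type*} [Field F] {ρ : MulChar F ℂ} {α : Fˣ} {q r h : ℕ}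

lemma gElt_ne_zero : gElt α q h ≠ 0 := pow_ne_zero _ α.ne_zero

section LinearRelation

variable {β g : F}

lemma periodArg_linear_relation (hβ : β ^ 2 + β + 1 = 0) (hg : g ≠ 0) (a b : F) :
    (a + β ^ 1 * b) * g ^ 1 * (β * g⁻¹) + ((a + β ^ 2 * b) * g ^ 2 * (β ^ 2 * g⁻¹ ^ 2) +
      (a + β ^ 3 * b) * g ^ 3 * g⁻¹ ^ 3) = 0 := by
  field_simp
  linear_combination (a + b * β ^ 2) * hβ

/-- The arguments `v₁` and `v₃` determine `a + β b` and `a + b`, hence `(a, b)`; the linear relation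
then gives `v₂`. -/
lemma exists_of_linear_relation (hβ : β ^ 2 + β + 1 = 0) (hβ1 : β ≠ 1) (hg : g ≠ 0)
    {v₁ v₂ v₃ : F} (hv : v₁ * (β * g⁻¹) + (v₂ * (β ^ 2 * g⁻¹ ^ 2) + v₃ * g⁻¹ ^ 3) = 0) :
    ∃ a b : F, (a + β ^ 1 * b) * g ^ 1 = v₁ ∧ (a + β ^ 2 * b) * g ^ 2 = v₂ ∧
      (a + β ^ 3 * b) * g ^ 3 = v₃ := by
  have h1 : 1 - β ≠ 0 := sub_ne_zero.mpr hβ1.symm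
  have hβ0 : β ≠ 0 := by rintro rfl; simp at hβ
  have hcube : β ^ 3 = 1 := by linear_combination (β - 1) * hβ
  obtain ⟨b, hb⟩ : ∃ b, (1 - β) * b = v₃ * g⁻¹ ^ 3 - v₁ * g⁻¹ :=
    ⟨(v₃ * g⁻¹ ^ 3 - v₁ * g⁻¹) / (1 - β), mul_div_cancel₀ _ h1⟩
  have e3 : v₃ * g⁻¹ ^ 3 * g ^ 3 = v₃ := by field_simp
  have e1 : v₁ * g⁻¹ * g = v₁ := by field_simp
  have e2 : v₂ * g⁻¹ ^ 2 * g ^ 2 = v₂ := by field_simp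
  have a1 : v₃ * g⁻¹ ^ 3 - b + β * b = v₁ * g⁻¹ := by linear_combination -hb
  have a2 : v₃ * g⁻¹ ^ 3 - b + β ^ 2 * b = v₂ * g⁻¹ ^ 2 := by
    refine mul_left_cancel₀ (pow_ne_zero 2 hβ0) ?_
    linear_combination (v₃ * g⁻¹ ^ 3) * hβ + b * (β ^ 2 - β) * hβ - hv - β * a1
  refine ⟨v₃ * g⁻¹ ^ 3 - b, b, ?_, ?_, ?_⟩
  · rw [pow_one, pow_one, a1, e1]
  · rw [a2, e2]
  · rw [hcube, one_mul, sub_add_cancel, e3]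

lemma eq_of_periodArg_eq (hβ1 : β ≠ 1) (hcube : β ^ 3 = 1) (hg : g ≠ 0) {a b a' b' : F}
    (h1 : (a + β ^ 1 * b) * g ^ 1 = (a' + β ^ 1 * b') * g ^ 1)
    (h3 : (a + β ^ 3 * b) * g ^ 3 = (a' + β ^ 3 * b') * g ^ 3) : a = a' ∧ b = b' := by
  have h1 := mul_right_cancel₀ (pow_ne_zero 1 hg) h1
  have h3 := mul_right_cancel₀ (pow_ne_zero 3 hg) h3
  rw [hcube] at h3
  have hb : b = b' := mul_left_cancel₀ (sub_ne_zero.mpr hβ1) (by linear_combination h1 - h3)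
  exact ⟨by linear_combination h3 - hb, hb⟩

end LinearRelation

variable [Fintype F]

/-- `β` is a primitive cube root of unity. -/
lemma betaElt_ne_one_and_sq_add (hα : ∀ x : Fˣ, x ∈ Subgroup.zpowers α)
    (h3 : 3 ∣ Fintype.card F - 1) :
    betaElt α (Fintype.card F) 3 ≠ 1 ∧
      betaElt α (Fintype.card F) 3 ^ 2 + betaElt α (Fintype.card F) 3 + 1 = 0 := by
  classical
  have hcard : 1 < Fintype.card F := Fintype.one_lt_card
  have hord : orderOf α = Fintype.card F - 1 := by
    rw [orderOf_eq_card_of_forall_mem_zpowers hα, Nat.card_eq_fintype_card, Fintype.card_units]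
  have h1 : betaElt α (Fintype.card F) 3 ≠ 1 := by
    rw [betaElt, ← Units.val_pow_eq_pow_val, Ne, Units.val_eq_one, ← orderOf_dvd_iff_pow_eq_one,
      hord]
    intro hd
    have := Nat.le_of_dvd (by omega) hd
    omega
  have hcube : betaElt α (Fintype.card F) 3 ^ 3 = 1 := by
    rw [betaElt, ← pow_mul, Nat.div_mul_cancel h3,
      FiniteField.pow_card_sub_one_eq_one _ α.ne_zero]
  refine ⟨h1, (mul_eq_zero.mp ?_).resolve_left (sub_ne_zero.mpr h1)⟩
  linear_combination hcube

/-- The classes of the three arguments of the periods: the pairs `(a, b)` correspond to the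
solutions of a linear equation. -/
lemma card_filter_periodArg_eq {ψ : AddChar F ℂ} (hρ : orderOf ρ = 3) (hψ : ψ.IsPrimitive) {t : ℂ}
    (ht : t ^ 2 + t + 1 = 0) (hβ : betaElt α r 3 ^ 2 + betaElt α r 3 + 1 = 0)
    (hβ1 : betaElt α r 3 ≠ 1) (hρβ : ρ (betaElt α r 3) = 1) {κ : F → Fin 4}
    (hκ : ∀ x, ρ x = classValue t (κ x)) (τ : Fin 4 × Fin 4 × Fin 4) :
    ((Finset.univ.filter fun x : F × F => (κ (periodArg α q r h 1 x.1 x.2),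
        κ (periodArg α q r h 2 x.1 x.2), κ (periodArg α q r h 3 x.1 x.2)) = τ).card : ℂ) =
      solutionCount (Fintype.card F) (gaussSum ρ ψ) (gaussSum ρ⁻¹ ψ) t
        (ρ (gElt α q h) ^ 2) (ρ (gElt α q h)) 1 τ.1 τ.2.1 τ.2.2 := by
  classical
  obtain ⟨i, j, k⟩ := τ
  have hg : gElt α q h ≠ 0 := gElt_ne_zero
  have hβ0 : betaElt α r 3 ≠ 0 := pow_ne_zero _ α.ne_zero
  have hinv : ρ (gElt α q h)⁻¹ = ρ (gElt α q h) ^ 2 := by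
    rw [← inv_apply_eq_sq hρ, MulChar.inv_apply']
  have hy := apply_pow_three hρ hg
  have hc₁ : ρ (betaElt α r 3 * (gElt α q h)⁻¹) = ρ (gElt α q h) ^ 2 := by
    rw [map_mul, hρβ, one_mul, hinv]
  have hc₂ : ρ (betaElt α r 3 ^ 2 * (gElt α q h)⁻¹ ^ 2) = ρ (gElt α q h) := by
    rw [map_mul, map_pow, map_pow, hρβ, hinv]
    linear_combination ρ (gElt α q h) * hy
  have hc₃ : ρ ((gElt α q h)⁻¹ ^ 3) = 1 := by
    rw [map_pow, hinv]
    linear_combination (ρ (gElt α q h) ^ 3 + 1) * hy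
  have hcube : betaElt α r 3 ^ 3 = 1 := by linear_combination (betaElt α r 3 - 1) * hβ
  have hκ' : ∀ x i, κ x = i ↔ ρ x = classValue t i := fun x i =>
    ⟨fun h => by rw [hκ, h], fun h => classValue_injective ht (by rw [← hκ, h])⟩
  have hcount := card_filter_linear_eq hρ hψ ht (mul_ne_zero hβ0 (inv_ne_zero hg))
    (mul_ne_zero (pow_ne_zero 2 hβ0) (pow_ne_zero 2 (inv_ne_zero hg)))
    (pow_ne_zero 3 (inv_ne_zero hg)) i j k
  rw [hc₁, hc₂, hc₃] at hcount
  rw [← hcount]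
  congr 1
  refine Finset.card_nbij (fun x => (periodArg α q r h 1 x.1 x.2,
    periodArg α q r h 2 x.1 x.2, periodArg α q r h 3 x.1 x.2)) (fun x hx => ?_)
    (fun x _ x' _ hxx => ?_) (fun v hv => ?_)
  · simp only [Finset.coe_filter, Finset.mem_univ, true_and, Set.mem_ofPred_eq, Prod.mk.injEq,
      hκ'] at hx ⊢
    exact ⟨hx, periodArg_linear_relation hβ hg x.1 x.2⟩
  · simp only [Prod.mk.injEq, periodArg] at hxx
    obtain ⟨h1, h2⟩ := eq_of_periodArg_eq hβ1 hcube hg hxx.1 hxx.2.2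
    exact Prod.ext h1 h2
  · simp only [Finset.coe_filter, Finset.mem_univ, true_and, Set.mem_ofPred_eq, Prod.mk.injEq,
      hκ', Set.mem_image] at hv ⊢
    obtain ⟨a, b, h1, h2, h3⟩ := exists_of_linear_relation hβ hβ1 hg hv.2
    have e : ((periodArg α q r h 1 a b, periodArg α q r h 2 a b, periodArg α q r h 3 a b) :
        F × F × F) = v := Prod.ext h1 (Prod.ext h2 h3)
    subst e
    exact ⟨(a, b), hv.1, rfl⟩

variable [Algebra (ZMod p) F] [Fact p.Prime]

/-- The period depends only on the class of its argument. -/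
lemma gaussPeriod_eq_of_apply_eq_classValue (hρ : orderOf ρ = 3)
    (hα : ∀ x : Fˣ, x ∈ Subgroup.zpowers α) {v : F} {i : Fin 4} (hv : ρ v = classValue (ρ α) i) :
    gaussPeriod p α 3 v = (![gaussPeriod p α 3 (1 : F), gaussPeriod p α 3 (α : F),
      gaussPeriod p α 3 ((α : F) ^ 2), ((Fintype.card F : ℂ) - 1) / 3] : Fin 4 → ℂ) i := by
  rcases eq_or_ne v 0 with rfl | h0
  · have hi : i = 3 := by
      refine classValue_injective (sq_add_apply_generator_eq_zero hρ hα) ?_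
      rw [← hv, MulChar.map_zero]
      rfl
    rw [hi, gaussPeriod_zero hρ hα]
    rfl
  · have hne : ρ v ≠ 0 := (h0.isUnit.map ρ).ne_zero
    rw [gaussPeriod_eq_cubicPeriod hρ hα h0, gaussPeriod_eq_cubicPeriod hρ hα one_ne_zero,
      gaussPeriod_eq_cubicPeriod hρ hα α.ne_zero,
      gaussPeriod_eq_cubicPeriod hρ hα (pow_ne_zero 2 α.ne_zero), map_one, map_pow, hv]
    fin_cases i
    · rfl
    · rfl
    · rfl
    · exact absurd hv hne

lemma sum_gaussPeriod_eq (hρ : orderOf ρ = 3) (hα : ∀ x : Fˣ, x ∈ Subgroup.zpowers α) :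
    gaussPeriod p α 3 (1 : F) + gaussPeriod p α 3 (α : F) + gaussPeriod p α 3 ((α : F) ^ 2) =
      -1 := by
  rw [gaussPeriod_eq_cubicPeriod hρ hα one_ne_zero, gaussPeriod_eq_cubicPeriod hρ hα α.ne_zero,
    gaussPeriod_eq_cubicPeriod hρ hα (pow_ne_zero 2 α.ne_zero), map_one, map_pow,
    ← sum_cubicPeriod (sq_add_apply_generator_eq_zero hρ hα) 1, mul_one, mul_one]

/-- The modified weights are distributed according to the classes of the arguments of the three
periods. -/
lemma isDistributedAs_modifiedWeight (hρ : orderOf ρ = 3)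
    (hα : ∀ x : Fˣ, x ∈ Subgroup.zpowers α) (hr : Fintype.card F = r) (h3 : 3 ∣ r - 1)
    (hN : paramN q r h 3 = 3) (hρβ : ρ (betaElt α r 3) = 1) {U V : ℂ}
    (hG : gaussSum ρ (psiChar p F) ^ 3 = -(r * U))
    (hH : gaussSum ρ⁻¹ (psiChar p F) ^ 3 = -(r * V))
    {row : Fin 4 → Fin 4 → Fin 4 → Fin 14} {weight freq : Fin 14 → ℂ}
    (hW : ∀ i j k, closedCount r U V (ρ α) (ρ (gElt α q h) ^ 2) (ρ (gElt α q h)) 1 i j k = 0 ∨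
      classWeight h q r (gaussPeriod p α 3 (1 : F)) (gaussPeriod p α 3 (α : F))
        (gaussPeriod p α 3 ((α : F) ^ 2)) i j k = weight (row i j k))
    (hfreq : ∀ i, ∑ τ : Fin 4 × Fin 4 × Fin 4 with row τ.1 τ.2.1 τ.2.2 = i,
      closedCount r U V (ρ α) (ρ (gElt α q h) ^ 2) (ρ (gElt α q h)) 1 τ.1 τ.2.1 τ.2.2 = freq i) :
    IsDistributedAs (fun x : F × F => modifiedWeight p α q r h 3 x.1 x.2) weight freq := by
  have ht := sq_add_apply_generator_eq_zero hρ hα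
  have hr0 : (r : ℂ) ≠ 0 := by
    rw [← hr]
    exact_mod_cast Fintype.card_ne_zero
  have hψ := isPrimitive_psiChar p (F := F)
  choose κ hκ using eq_classValue hρ ht
  obtain ⟨hβ1, hβ⟩ := betaElt_ne_one_and_sq_add hα (by rwa [hr])
  rw [hr] at hβ1 hβ
  refine isDistributedAs_of_fiber_card
    (fun x : F × F => (κ (periodArg α q r h 1 x.1 x.2), κ (periodArg α q r h 2 x.1 x.2),
      κ (periodArg α q r h 3 x.1 x.2)))
    (fun τ => row τ.1 τ.2.1 τ.2.2)
    (W := fun τ => classWeight h q r (gaussPeriod p α 3 (1 : F)) (gaussPeriod p α 3 (α : F))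
      (gaussPeriod p α 3 ((α : F) ^ 2)) τ.1 τ.2.1 τ.2.2)
    (fun x => ?_) (fun τ => ?_) (fun τ => hW _ _ _) hfreq
  · rw [modifiedWeight_eq hN, gaussPeriod_eq_of_apply_eq_classValue hρ hα (hκ _),
      gaussPeriod_eq_of_apply_eq_classValue hρ hα (hκ (periodArg α q r h 2 x.1 x.2)),
      gaussPeriod_eq_of_apply_eq_classValue hρ hα (hκ (periodArg α q r h 3 x.1 x.2)), hr]
    rfl
  · rw [card_filter_periodArg_eq hρ hψ ht hβ hβ1 hρβ hκ τ, hr,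
      solutionCount_eq_closedCount ht hr0 _ hG hH]
    rw [gaussSum_mul_gaussSum_inv hρ hψ, hr]

lemma isDistributedAs_weightsA (hρ : orderOf ρ = 3)
    (hα : ∀ x : Fˣ, x ∈ Subgroup.zpowers α) (hr : Fintype.card F = r) (h3 : 3 ∣ r - 1)
    (hN : paramN q r h 3 = 3) (hρβ : ρ (betaElt α r 3) = 1) {k : ℕ} {ϖ : ℂ}
    (hG : gaussSum ρ (psiChar p F) ^ 3 = -(r * ((-1) ^ k * ϖ ^ k)))
    (hH : gaussSum ρ⁻¹ (psiChar p F) ^ 3 = -(r * ((-1) ^ k * conj ϖ ^ k)))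
    (hg : ρ (gElt α q h) = 1) :
    IsDistributedAs (fun x : F × F => modifiedWeight p α q r h 3 x.1 x.2)
      (weightsA h q r (gaussPeriod p α 3 (1 : F)) (gaussPeriod p α 3 (α : F))
        (gaussPeriod p α 3 ((α : F) ^ 2))) (freqsA r k ϖ (ρ α)) := by
  have ht := sq_add_apply_generator_eq_zero hρ hα
  refine isDistributedAs_modifiedWeight hρ hα hr h3 hN hρβ hG hH
    (row := tripleRow pairRowA) (fun i j k => ?_) (fun i => ?_)
  · rw [hg, one_pow]
    exact closedCount_eq_zero_or_weightsA ht (sum_gaussPeriod_eq hρ hα) i j k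
  · rw [hg, one_pow]
    exact sum_closedCount_eq_freqsA ht rfl rfl i

lemma isDistributedAs_weightsB (hρ : orderOf ρ = 3)
    (hα : ∀ x : Fˣ, x ∈ Subgroup.zpowers α) (hr : Fintype.card F = r) (h3 : 3 ∣ r - 1)
    (hN : paramN q r h 3 = 3) (hρβ : ρ (betaElt α r 3) = 1) {k : ℕ} {ϖ : ℂ}
    (hG : gaussSum ρ (psiChar p F) ^ 3 = -(r * ((-1) ^ k * ϖ ^ k)))
    (hH : gaussSum ρ⁻¹ (psiChar p F) ^ 3 = -(r * ((-1) ^ k * conj ϖ ^ k)))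
    (hg : ρ (gElt α q h) = ρ α ∨ ρ (gElt α q h) = ρ α ^ 2) :
    IsDistributedAs (fun x : F × F => modifiedWeight p α q r h 3 x.1 x.2)
      (weightsB h q r (gaussPeriod p α 3 (1 : F)) (gaussPeriod p α 3 (α : F))
        (gaussPeriod p α 3 ((α : F) ^ 2))) (freqsB r k ϖ (ρ α)) := by
  have ht := sq_add_apply_generator_eq_zero hρ hα
  exact isDistributedAs_modifiedWeight hρ hα hr h3 hN hρβ hG hH (row := tripleRow pairRowB)
    (fun i j k => closedCount_eq_zero_or_weightsB ht hg (sum_gaussPeriod_eq hρ hα) i j k)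
    (fun i => sum_closedCount_eq_freqsB ht hg rfl rfl i)

end Distribution

/-! ### The code and its parameters -/

section Injective

variable {K F : Type*} [Field K] [Field F] [Algebra K F] {ρ : MulChar F ℂ} {α : Fˣ} {q r h : ℕ}

lemma codeword_sub (a b a' b' : F) :
    codeword K α q r h 3 (a - a') (b - b') =
      codeword K α q r h 3 a b - codeword K α q r h 3 a' b' := by
  funext i
  simp only [codeword, Pi.sub_apply, ← map_sub]
  congr 1
  ring

variable {p : ℕ} [Fintype F] [Algebra (ZMod p) F]

/-- The distribution over the pairs carries over to the codewords. -/
lemma IsDistributedAs.codewords [DecidableEq K] {ι : Type*} [Fintype ι] {weight freq : ι → ℂ}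
    (hinj : Function.Injective fun x : F × F => codeword K α q r h 3 x.1 x.2)
    (hweight : ∀ a b : F, (hammingNorm (codeword K α q r h 3 a b) : ℂ) =
      (h : ℂ) * ((r : ℂ) - 1) / (q : ℂ) - modifiedWeight p α q r h 3 a b)
    (hdist : IsDistributedAs (fun x : F × F => modifiedWeight p α q r h 3 x.1 x.2) weight freq) :
    IsDistributedAs (fun c : code K α q r h 3 =>
      (h : ℂ) * ((r : ℂ) - 1) / (q : ℂ) - (hammingNorm c.1 : ℂ)) weight freq := by
  refine hdist.of_equiv (Equiv.ofInjective _ hinj) fun x => ?_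
  change (h : ℂ) * ((r : ℂ) - 1) / (q : ℂ) - hammingNorm (codeword K α q r h 3 x.1 x.2) = _
  rw [hweight, sub_sub_cancel]

variable [Fact p.Prime]

lemma norm_gaussPeriod_le (hρ : orderOf ρ = 3) (hα : ∀ x : Fˣ, x ∈ Subgroup.zpowers α)
    (hr : 9 ≤ Fintype.card F) (u : F) :
    ‖gaussPeriod p α 3 u‖ ≤ ((Fintype.card F : ℝ) - 1) / 3 := by
  rcases eq_or_ne u 0 with rfl | hu
  · have h1 : ((Fintype.card F : ℂ) - 1) / 3 = (((Fintype.card F : ℝ) - 1) / 3 : ℝ) := by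
      push_cast
      rfl
    rw [gaussPeriod_zero hρ hα, h1, Complex.norm_real, Real.norm_of_nonneg]
    have : (9 : ℝ) ≤ Fintype.card F := by exact_mod_cast hr
    linarith
  · exact (norm_gaussPeriod_lt hρ hα hr hu).le

/-- Three periods add up to `r - 1` only if all of their arguments vanish. -/
lemma eq_zero_of_sum_gaussPeriod_eq (hρ : orderOf ρ = 3)
    (hα : ∀ x : Fˣ, x ∈ Subgroup.zpowers α) (hr : 9 ≤ Fintype.card F) {u v w : F}
    (hsum : gaussPeriod p α 3 u + gaussPeriod p α 3 v + gaussPeriod p α 3 w =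
      (Fintype.card F : ℂ) - 1) : u = 0 ∧ w = 0 := by
  have h1 : ((Fintype.card F : ℂ) - 1) = ((Fintype.card F : ℝ) - 1 : ℝ) := by push_cast; rfl
  have h2 : (Fintype.card F : ℝ) - 1 ≤
      ‖gaussPeriod p α 3 u‖ + ‖gaussPeriod p α 3 v‖ + ‖gaussPeriod p α 3 w‖ := by
    refine le_trans (le_abs_self _) ?_
    rw [← Real.norm_eq_abs, ← Complex.norm_real, ← h1, ← hsum]
    exact norm_add₃_le
  have hv := norm_gaussPeriod_le (p := p) hρ hα hr v
  constructor
  · by_contra hu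
    have := norm_gaussPeriod_lt (p := p) hρ hα hr hu
    have := norm_gaussPeriod_le (p := p) hρ hα hr w
    linarith
  · by_contra hw
    have := norm_gaussPeriod_lt (p := p) hρ hα hr hw
    have := norm_gaussPeriod_le (p := p) hρ hα hr u
    linarith

/-- The pair `(a, b)` is determined by its codeword, as only the pair `(0, 0)` has
weight zero. -/
lemma codeword_injective [DecidableEq K] (hρ : orderOf ρ = 3)
    (hα : ∀ x : Fˣ, x ∈ Subgroup.zpowers α)
    (hr : Fintype.card F = r) (hr9 : 9 ≤ r) (h3 : 3 ∣ r - 1) (hh : h ≠ 0) (hq : q ≠ 0)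
    (hN : paramN q r h 3 = 3)
    (hweight : ∀ a b : F, (hammingNorm (codeword K α q r h 3 a b) : ℂ) =
      (h : ℂ) * ((r : ℂ) - 1) / (q : ℂ) - modifiedWeight p α q r h 3 a b) :
    Function.Injective fun x : F × F => codeword K α q r h 3 x.1 x.2 := by
  rintro ⟨a, b⟩ ⟨a', b'⟩ hab
  have h0 : codeword K α q r h 3 (a - a') (b - b') = 0 := by
    rw [codeword_sub, sub_eq_zero]
    exact hab
  have h1 := hweight (a - a') (b - b')
  have hh' : (h : ℂ) ≠ 0 := Nat.cast_ne_zero.mpr hh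
  have hq' : (q : ℂ) ≠ 0 := Nat.cast_ne_zero.mpr hq
  rw [h0, hammingNorm_zero, Nat.cast_zero, modifiedWeight_eq hN, eq_comm, sub_eq_zero,
    mul_div_right_comm] at h1
  have h2 := mul_left_cancel₀ (div_ne_zero hh' hq') h1
  rw [← hr] at h2
  obtain ⟨hv₁, hv₃⟩ := eq_zero_of_sum_gaussPeriod_eq hρ hα (hr.symm ▸ hr9) h2.symm
  rw [← hr] at h3
  obtain ⟨hβ1, hβ⟩ := betaElt_ne_one_and_sq_add hα h3
  have hcube : betaElt α (Fintype.card F) 3 ^ 3 = 1 := by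
    linear_combination (betaElt α (Fintype.card F) 3 - 1) * hβ
  obtain ⟨ha, hb⟩ := eq_of_periodArg_eq (a := a - a') (b := b - b') (a' := 0) (b' := 0) hβ1 hcube
    (gElt_ne_zero (α := α) (q := q) (h := h)) (hv₁.trans (by ring)) (hv₃.trans (by ring))
  exact Prod.ext (sub_eq_zero.mp ha) (sub_eq_zero.mp hb)

end Injective

section Parameters

/-- As `q ≡ 1 (mod 3)`, the sum `1 + q + ... + q ^ (m - 1)` is congruent to `m`. -/
lemma three_dvd_of_dvd_div {q m : ℕ} (hq : q % 3 = 1) (hq2 : 2 ≤ q)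
    (h : 3 ∣ (q ^ m - 1) / (q - 1)) : 3 ∣ m := by
  rw [← Nat.geomSum_eq hq2] at h
  have h1 : ∑ i ∈ Finset.range m, q ^ i ≡ ∑ i ∈ Finset.range m, 1 [MOD 3] := by
    refine Nat.ModEq.sum fun i _ => ?_
    simpa using Nat.ModEq.pow i (show q ≡ 1 [MOD 3] from hq)
  rw [Finset.sum_const, Finset.card_range, smul_eq_mul, mul_one] at h1
  exact (h1.dvd_iff dvd_rfl).mp h

/-- The divisibility conditions on the parameters, with `A = (r - 1) / (3 (q - 1))` and
`B = (q - 1) / h`. -/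
lemma exists_parameters {q m h : ℕ} (hq : q % 3 = 1) (hq2 : 2 ≤ q) (hh : h ∣ q - 1)
    (hN : paramN q (q ^ m) h 3 = 3) :
    3 ∣ m ∧ ∃ A B, (q - 1) / h = B ∧ q - 1 = h * B ∧ q ^ m - 1 = 3 * A * (h * B) ∧
      Nat.gcd (3 * A) (3 * B) = 3 := by
  have hd : 3 ∣ (q ^ m - 1) / (q - 1) := by
    rw [← hN]
    exact Nat.gcd_dvd_left _ _
  have hB : q - 1 = h * ((q - 1) / h) := (Nat.mul_div_cancel' hh).symm
  obtain ⟨A, hA⟩ := hd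
  refine ⟨three_dvd_of_dvd_div hq hq2 ⟨A, hA⟩, A, _, rfl, hB, ?_, ?_⟩
  · rw [← hB, ← hA]
    have h1 : q - 1 ∣ q ^ m - 1 := by simpa using Nat.sub_dvd_pow_sub_pow q 1 m
    exact (Nat.div_mul_cancel h1).symm
  · rw [← hA]
    exact hN

end Parameters

section Periods

/-- The sign of the Gauss sum cubes to `-(-1) ^ k`, as `k` is a multiple of three. -/
lemma gaussSum_pow_three_eq {p k : ℕ} {G ϖ : ℂ} (hk : 3 ∣ k)
    (hG : G = (-1) ^ (k + 1) * ((p : ℂ) * ϖ) ^ (k / 3)) :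
    G ^ 3 = -((p ^ k : ℕ) * ((-1) ^ k * ϖ ^ k)) := by
  obtain ⟨l, rfl⟩ := hk
  have h1 : ((-1 : ℂ) ^ (3 * l + 1)) ^ 3 = -(-1) ^ (3 * l) := by
    rcases neg_one_pow_eq_or ℂ (3 * l) with h | h <;>
      rw [pow_succ (-1 : ℂ) (3 * l), h] <;> norm_num
  rw [hG, Nat.mul_div_cancel_left l (by norm_num), mul_pow, h1]
  push_cast
  ring

variable {p : ℕ} [Fact p.Prime] {F : Type*} [Field F] [Fintype F] [Algebra (ZMod p) F]
  {ρ : MulChar F ℂ} {α : Fˣ}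

/-- The period at `u ≠ 0`, when the Gauss sum is `± (p ϖ) ^ (k / 3)`. -/
lemma gaussPeriod_eq_of_gaussSum_eq (hρ : orderOf ρ = 3)
    (hα : ∀ x : Fˣ, x ∈ Subgroup.zpowers α) {k : ℕ} (hk : 3 ∣ k) {ϖ : ℂ}
    (hG : gaussSum ρ (psiChar p F) = (-1) ^ (k + 1) * ((p : ℂ) * ϖ) ^ (k / 3)) {u : F}
    (hu : u ≠ 0) :
    gaussPeriod p α 3 u = ((-1) ^ (k + 1) * (((((p ^ k : ℕ) : ℝ) ^ (1 / 3 : ℝ) : ℝ) : ℂ)) *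
      (ρ u ^ 2 * ϖ ^ (k / 3) + ρ u * conj ϖ ^ (k / 3)) - 1) / 3 := by
  obtain ⟨l, rfl⟩ := hk
  have hroot : ((p ^ (3 * l) : ℕ) : ℝ) ^ (1 / 3 : ℝ) = (p : ℝ) ^ l := by
    have h1 := Real.pow_rpow_inv_natCast (x := (p : ℝ) ^ l) (by positivity) (three_ne_zero)
    rw [← h1]
    push_cast
    rw [mul_comm, pow_mul, one_div]
  rw [gaussPeriod_eq_cubicPeriod hρ hα hu, gaussSum_inv_eq_conj hρ, hG, hroot, cubicPeriod]
  rw [Nat.mul_div_cancel_left l (by norm_num)]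
  simp only [map_mul, map_pow, map_neg, map_one, Complex.conj_natCast]
  push_cast
  ring

end Periods

end CyclicCode

end

theorem theorem2
    -- the finite fields `𝔽_p ⊆ K = 𝔽_q ⊆ F = 𝔽_r` with `q = p ^ s`, `r = q ^ m`
    (p s m q r : ℕ) [Fact p.Prime] (hs : 0 < s) (hm : 0 < m)
    (hq : q = p ^ s) (hr : r = q ^ m)
    {K F : Type*} [Field K] [Field F] [Fintype K] [Fintype F] [DecidableEq K]
    [Algebra (ZMod p) F] [Algebra K F]
    (hK : Fintype.card K = q) (hF : Fintype.card F = r)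
    -- a generator of the multiplicative group of `F`
    (α : Fˣ) (hα : ∀ x : Fˣ, x ∈ Subgroup.zpowers α)
    -- the parameters `h` and `e = N = 3`
    (h : ℕ) (hh : h ∣ q - 1) (he : 3 ∣ Nat.gcd (q - 1) (h * m))
    (hN : CyclicCode.paramN q r h 3 = 3)
    (hp : p % 3 = 1) :
    -- `ϖ` exists and is unique up to complex conjugation
    (∃ ϖ₀ : CyclicCode.ZOmega, ∀ ϖ : CyclicCode.ZOmega,
      CyclicCode.IsPrimaryOver p ϖ ↔
        (ϖ = ϖ₀ ∨ (ϖ : ℂ) = (starRingEnd ℂ) (ϖ₀ : ℂ))) ∧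
    -- the Hamming weight and the modified weight
    (∀ a b : F, (hammingNorm (CyclicCode.codeword K α q r h 3 a b) : ℂ) =
      (h : ℂ) * ((r : ℂ) - 1) / (q : ℂ) - CyclicCode.modifiedWeight p α q r h 3 a b) ∧
    -- for each of the two choices of `ϖ`
    ∀ ϖ : CyclicCode.ZOmega, CyclicCode.IsPrimaryOver p ϖ →
      -- the residue ring of `ϖ` is the field with `p` elements
      Nonempty ((CyclicCode.ZOmega ⧸ Ideal.span {ϖ}) ≃+* ZMod p) ∧
      -- `ρ` is a cubic character
      (∃ χ : MulChar F ℂ, orderOf χ = 3 ∧ ∀ x : F, χ x = CyclicCode.rho p ϖ x) ∧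
      -- the three Gaussian periods
      CyclicCode.gaussPeriod p α 3 (1 : F) =
        ((-1) ^ (s * m + 1) * (((r : ℝ) ^ (1 / 3 : ℝ) : ℝ) : ℂ) *
          ((ϖ : ℂ) ^ (s * m / 3) + (starRingEnd ℂ) (ϖ : ℂ) ^ (s * m / 3)) - 1) / 3 ∧
      CyclicCode.gaussPeriod p α 3 (α : F) =
        ((-1) ^ (s * m + 1) * (((r : ℝ) ^ (1 / 3 : ℝ) : ℝ) : ℂ) *
          (CyclicCode.rho p ϖ (α : F) ^ 2 * (ϖ : ℂ) ^ (s * m / 3) +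
            CyclicCode.rho p ϖ (α : F) * (starRingEnd ℂ) (ϖ : ℂ) ^ (s * m / 3)) - 1) / 3 ∧
      CyclicCode.gaussPeriod p α 3 ((α : F) ^ 2) =
        ((-1) ^ (s * m + 1) * (((r : ℝ) ^ (1 / 3 : ℝ) : ℝ) : ℂ) *
          (CyclicCode.rho p ϖ (α : F) * (ϖ : ℂ) ^ (s * m / 3) +
            CyclicCode.rho p ϖ (α : F) ^ 2 * (starRingEnd ℂ) (ϖ : ℂ) ^ (s * m / 3)) - 1) / 3 ∧
      -- the modified weight distribution, counted over the pairs `(a, b)` and over the codewords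
      (3 ∣ (q - 1) / h →
        CyclicCode.IsDistributedAs
          (fun x : F × F => CyclicCode.modifiedWeight p α q r h 3 x.1 x.2)
          (CyclicCode.weightsA h q r (CyclicCode.gaussPeriod p α 3 (1 : F))
            (CyclicCode.gaussPeriod p α 3 (α : F)) (CyclicCode.gaussPeriod p α 3 ((α : F) ^ 2)))
          (CyclicCode.freqsA r (m * s) ϖ (CyclicCode.rho p ϖ (α : F))) ∧
        CyclicCode.IsDistributedAs
          (fun c : CyclicCode.code K α q r h 3 =>
            (h : ℂ) * ((r : ℂ) - 1) / (q : ℂ) - (hammingNorm c.1 : ℂ))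
          (CyclicCode.weightsA h q r (CyclicCode.gaussPeriod p α 3 (1 : F))
            (CyclicCode.gaussPeriod p α 3 (α : F)) (CyclicCode.gaussPeriod p α 3 ((α : F) ^ 2)))
          (CyclicCode.freqsA r (m * s) ϖ (CyclicCode.rho p ϖ (α : F)))) ∧
      (¬ 3 ∣ (q - 1) / h →
        CyclicCode.IsDistributedAs
          (fun x : F × F => CyclicCode.modifiedWeight p α q r h 3 x.1 x.2)
          (CyclicCode.weightsB h q r (CyclicCode.gaussPeriod p α 3 (1 : F))
            (CyclicCode.gaussPeriod p α 3 (α : F)) (CyclicCode.gaussPeriod p α 3 ((α : F) ^ 2)))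
          (CyclicCode.freqsB r (m * s) ϖ (CyclicCode.rho p ϖ (α : F))) ∧
        CyclicCode.IsDistributedAs
          (fun c : CyclicCode.code K α q r h 3 =>
            (h : ℂ) * ((r : ℂ) - 1) / (q : ℂ) - (hammingNorm c.1 : ℂ))
          (CyclicCode.weightsB h q r (CyclicCode.gaussPeriod p α 3 (1 : F))
            (CyclicCode.gaussPeriod p α 3 (α : F)) (CyclicCode.gaussPeriod p α 3 ((α : F) ^ 2)))
          (CyclicCode.freqsB r (m * s) ϖ (CyclicCode.rho p ϖ (α : F)))) := by
  classical
  subst hq hr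
  have hpp : p.Prime := Fact.out
  have hp7 : 7 ≤ p := by
    have := hpp.two_le
    by_contra hlt
    -- the numbers congruent to `1` modulo `3` below `7` are `1` and `4`
    have h4 : p = 4 := by omega
    rw [h4] at hpp
    exact absurd hpp (by norm_num)
  have hq1 : p ^ s % 3 = 1 := by simp [Nat.pow_mod, hp]
  have hq7 : 7 ≤ p ^ s := hp7.trans (Nat.le_self_pow hs.ne' p)
  obtain ⟨hm3, A, B, hB, hqB, hrB, hgcd⟩ :=
    CyclicCode.exists_parameters hq1 (by omega) hh hN
  have hr9 : 9 ≤ (p ^ s) ^ m := by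
    have h3m : 3 ≤ m := Nat.le_of_dvd hm hm3
    calc 9 ≤ 7 ^ 3 := by norm_num
      _ ≤ (p ^ s) ^ 3 := Nat.pow_le_pow_left hq7 3
      _ ≤ (p ^ s) ^ m := Nat.pow_le_pow_right (by omega) h3m
  have hhB3 : 3 ∣ h * B := by rw [← hqB]; omega
  have hh0 : h ≠ 0 := by rintro rfl; omega
  have hr3 : 3 ∣ (p ^ s) ^ m - 1 := ⟨A * (h * B), by rw [hrB]; ring⟩
  have hk : 3 ∣ s * m := hm3.mul_left s
  have hF' : Fintype.card F = p ^ (s * m) := by rw [hF, ← pow_mul]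
  -- any cubic character serves for the weight formula, which does not mention `ϖ`
  have hweight : ∀ a b : F,
      (hammingNorm (CyclicCode.codeword K α (p ^ s) ((p ^ s) ^ m) h 3 a b) : ℂ) =
        (h : ℂ) * (((p ^ s) ^ m : ℕ) - 1) / (p ^ s : ℕ) -
        CyclicCode.modifiedWeight p α (p ^ s) ((p ^ s) ^ m) h 3 a b := fun a b => by
    obtain ⟨ϖ, hϖ⟩ := CyclicCode.exists_isPrimaryOver hp
    obtain ⟨ρ, hρ, -, -⟩ := CyclicCode.exists_mulChar_eq_rho hp hϖ hF' hk
    exact CyclicCode.hammingNorm_codeword_eq hρ hα hK hF hqB hrB hgcd hN a b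
  refine ⟨?_, hweight, fun ϖ hϖ => ?_⟩
  · obtain ⟨ϖ₀, hϖ₀⟩ := CyclicCode.exists_isPrimaryOver hp
    exact ⟨ϖ₀, fun ϖ => hϖ₀.iff_eq_or_conj⟩
  obtain ⟨ρ, hρ, hρϖ, hG⟩ := CyclicCode.exists_mulChar_eq_rho hp hϖ hF' hk
  have hperiod := fun (u : F) (hu : u ≠ 0) =>
    CyclicCode.gaussPeriod_eq_of_gaussSum_eq hρ hα hk hG hu
  have hα3 := CyclicCode.apply_pow_three hρ α.ne_zero
  have hρpow : ∀ j, 3 ∣ j → ρ α ^ j = 1 := by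
    rintro _ ⟨j, rfl⟩
    rw [pow_mul, hα3, one_pow]
  -- `β` is a cube, and `g` is a cube exactly if `3 ∣ (q - 1) / h`
  have hρβ : ρ (CyclicCode.betaElt α ((p ^ s) ^ m) 3) = 1 := by
    rw [CyclicCode.betaElt, map_pow]
    refine hρpow _ ?_
    rw [hrB, mul_assoc, Nat.mul_div_cancel_left _ (by norm_num)]
    exact hhB3.mul_left A
  have hρg : ρ (CyclicCode.gElt α (p ^ s) h) = ρ α ^ B := by
    rw [CyclicCode.gElt, map_pow, hB]
  have hG3 := CyclicCode.gaussSum_pow_three_eq hk hG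
  have hH3 : gaussSum ρ⁻¹ (CyclicCode.psiChar p F) ^ 3 =
      -((p ^ (s * m) : ℕ) * ((-1) ^ (s * m) * conj (ϖ : ℂ) ^ (s * m))) := by
    refine CyclicCode.gaussSum_pow_three_eq hk ?_
    rw [CyclicCode.gaussSum_inv_eq_conj hρ, hG]
    simp
  rw [pow_mul, mul_comm s m] at hG3 hH3
  have hinj := CyclicCode.codeword_injective (K := K) hρ hα hF hr9 hr3 hh0 (by omega) hN hweight
  refine ⟨hϖ.nonempty_quotient_equiv, ⟨ρ, hρ, hρϖ⟩, ?_, ?_, ?_, fun h3 => ?_, fun h3 => ?_⟩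
  · rw [hperiod 1 one_ne_zero, map_one, one_pow, one_mul, one_mul, pow_mul]
  · rw [hperiod α α.ne_zero, hρϖ, pow_mul]
  · rw [hperiod _ (pow_ne_zero 2 α.ne_zero), map_pow, ← pow_mul, ← hρϖ, pow_mul p s m]
    have h4 : ρ α ^ (2 * 2) = ρ α := by linear_combination ρ α * hα3
    rw [h4]
  · rw [← hρϖ]
    have hdist := CyclicCode.isDistributedAs_weightsA (p := p) hρ hα hF hr3 hN hρβ hG3 hH3
      (by rw [hρg]; exact hρpow B (hB ▸ h3))
    exact ⟨hdist, hdist.codewords hinj hweight⟩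
  · rw [← hρϖ]
    have hdist := CyclicCode.isDistributedAs_weightsB (p := p) hρ hα hF hr3 hN hρβ hG3 hH3 (by
      rw [hB] at h3
      rw [hρg, ← Nat.div_add_mod B 3, pow_add, hρpow _ (dvd_mul_right _ _), one_mul]
      rcases (show B % 3 = 1 ∨ B % 3 = 2 by omega) with h1 | h1 <;> rw [h1]
      · exact Or.inl (pow_one _)
      · exact Or.inr rfl)
    exact ⟨hdist, hdist.codewords hinj hweight⟩
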